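/- Let $n\ge 1$. A loop-free bigraph $\Delta$ on the vertex set $\{1,\dots,n\}$ is a finite loop-free undirected multigraph whose edges are of two kinds, solid and dotted, such that no two vertices are joined by edges of both kinds. It is connected if its underlying graph (forgetting the kinds of edges) is connected. For $a\neq b$ let $d_{ab}=d_{ba}$ be the number of dotted edges between $a$ and $b$ minus the number of solid edges between $a$ and $b$. The Gram matrix $\check G_\Delta\in M_n(\mathbb Z)$ is the upper-triangular matrix with $1$'s on the diagonal and with the entry $d_{ij}$ at $(i,j)$ for $i<j$; put $q_\Delta(x)=x^{\mathrm{tr}}\check G_\Delta x$. The bigraph $\Delta$ is positive if $q_\Delta(x)>0$ for all $0\ne x\in\mathbb R^n$. A vector $v\in\mathbb Z^n$ is a positive sincere root of $q_\Delta$ if $q_\Delta(v)=1$, $v\ne0$, and $v_i\ge 0$ and $v_i\neq 0$ for all $i$. If $a\ne b$ are joined by at least one dotted edge, the inflation of $\Delta$ at the pair $(a,b)$ is the bigraph on the same vertices obtained by replacing all (dotted) edges between $a$ and $b$ by solid ones, replacing $d_{bc}$ by $d_{bc}-d_{ac}d_{ab}$ for every $c\neq a,b$, and keeping all other edges. The pair-inflation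 loop is: while $\Delta$ has a dotted edge, select a dotted edge $a\cdots b$ with respect to a fixed strategy and replace $\Delta$ by its inflation at $(a,b)$; when there is no dotted edge left, return the resulting graph $D$. The strategy is one of the following four: select the first dotted edge; select the last one; select the first or the last one, at random at each step; select any dotted edge at random (in either orientation). Here first and last refer to the lexicographic order on pairs $(a,b)$, $a<b$, representing the dotted edges. A Dynkin graph is a graph isomorphic to one of $\mathbb A_n$ ($n\ge1$), $\mathbb D_n$ ($n\ge4$), $\mathbb E_6$, $\mathbb E_7$, $\mathbb E_8$. **Theorem.** Let $\Delta$ be a connected loop-free bigraph on $n\ge1$ vertices, and fix any of the four strategies. (a) Let $\mathrm{ig}_{pos}(n)=\tfrac12(n^2-n)$ for $n\in\{1,2,3\}$, $\mathrm{ig}_{pos}(6)=30$, $\mathrm{ig}_{pos}(7)=56$, $\mathrm{ig}_{pos}(8)=112$, and $\mathrm{ig}_{pos}(n)=n^2-2n$ otherwise. Then $\Delta$ is positive if and only if the pair-inflation loop, applied to $\Delta$ with the chosen strategy, stops after at most $\mathrm{ig}_{pos}(n)$ inflations and returns a Dynkin graph. (b) Let $\mathrm{ig}_{poss}(n)=0$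 for $n\in\{1,2,3\}$, $\mathrm{ig}_{poss}(6)=5$, $\mathrm{ig}_{poss}(7)=10$, $\mathrm{ig}_{poss}(8)=21$, and $\mathrm{ig}_{poss}(n)=n-3$ otherwise. If $q_\Delta$ has a positive sincere root, then $\Delta$ is positive if and only if the pair-inflation loop, applied to $\Delta$ with the chosen strategy, stops after at most $\mathrm{ig}_{poss}(n)$ inflations and returns a Dynkin graph. For the randomized strategies both equivalences hold in either sense: the right-hand condition may be required of every run of the loop, or only of some run. -/

import Mathlib

/-- A bigraph (edge-bipartite graph) on the vertex set `{1, …, n}`, which is modelled with its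
order by `Fin n`. The finite multisets of solid and of dotted edges are given by their
multiplicities: `solid a b` and `dotted a b` are the numbers of solid and of dotted edges between
`a` and `b` (loops if `a = b`). No two vertices are joined by edges of both kinds. -/
@[ext]
structure Bigraph (n : ℕ) where
  solid : Fin n → Fin n → ℕ
  dotted : Fin n → Fin n → ℕ
  solid_symm : ∀ a b, solid a b = solid b a
  dotted_symm : ∀ a b, dotted a b = dotted b a
  one_kind : ∀ a b, solid a b = 0 ∨ dotted a b = 0

namespace Bigraph

variable {n : ℕ}

/-- There are no loops. -/
def LoopFree (Δ : Bigraph n) : Prop :=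
  ∀ a, Δ.solid a a = 0 ∧ Δ.dotted a a = 0

/-- The underlying graph, in which the kind and the multiplicity of edges are forgotten. -/
def underlying (Δ : Bigraph n) : SimpleGraph (Fin n) where
  Adj a b := a ≠ b ∧ (Δ.solid a b ≠ 0 ∨ Δ.dotted a b ≠ 0)
  symm := ⟨fun a b h => ⟨h.1.symm, by rw [Δ.solid_symm b a, Δ.dotted_symm b a]; exact h.2⟩⟩
  loopless := ⟨fun _ h => h.1 rfl⟩

def Connected (Δ : Bigraph n) : Prop := Δ.underlying.Connected

/-- The coefficient `d_{ab} = d_{ba}`: the number of edges between `a` and `b`, counted with sign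
`+` if they are dotted and with sign `-` if they are solid. -/
def coeff (Δ : Bigraph n) (a b : Fin n) : ℤ := (Δ.dotted a b : ℤ) - (Δ.solid a b : ℤ)

theorem coeff_symm (Δ : Bigraph n) (a b : Fin n) : Δ.coeff a b = Δ.coeff b a := by
  simp only [coeff, Δ.solid_symm a b, Δ.dotted_symm a b]

/-- The upper-triangular unidiagonal Gram matrix of a loop-free bigraph. -/
def gram (Δ : Bigraph n) : Matrix (Fin n) (Fin n) ℤ :=
  Matrix.of fun i j => if i = j then 1 else if i < j then Δ.coeff i j else 0

end Bigraph

/-- The quadratic form `q_A(x) = xᵗ A x` of a square matrix. -/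
def matrixForm {n : ℕ} {R : Type*} [CommRing R] (A : Matrix (Fin n) (Fin n) R)
    (x : Fin n → R) : R :=
  x ⬝ᵥ A.mulVec x

namespace Bigraph

variable {n : ℕ}

/-- The Gram matrix is positive definite over the reals. -/
def Positive (Δ : Bigraph n) : Prop :=
  ∀ x : Fin n → ℝ, x ≠ 0 → 0 < matrixForm (Δ.gram.map (Int.cast : ℤ → ℝ)) x

/-- The integral quadratic form `q_Δ : ℤⁿ → ℤ`. -/
def form (Δ : Bigraph n) (v : Fin n → ℤ) : ℤ := matrixForm Δ.gram v

/-- `v` is a root of `q_Δ` that is positive (nonzero with nonnegative coordinates) and sincere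
(no coordinate vanishes). -/
def IsPositiveSincereRoot (Δ : Bigraph n) (v : Fin n → ℤ) : Prop :=
  Δ.form v = 1 ∧ (v ≠ 0 ∧ ∀ i, 0 ≤ v i) ∧ ∀ i, v i ≠ 0

/-- The bigraph with prescribed (symmetric) coefficients. -/
def ofCoeff (d : Fin n → Fin n → ℤ) (hd : ∀ a b, d a b = d b a) : Bigraph n where
  solid a b := (-d a b).toNat
  dotted a b := (d a b).toNat
  solid_symm a b := by rw [hd]
  dotted_symm a b := by rw [hd]
  one_kind a b := by omega

/-- The coefficients after the inflation at the pair `(a, b)`: the edges between `a` and `b`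
change their kind, `d_{bc}` becomes `d_{bc} - d_{ac} d_{ab}` for `c ≠ a, b`, and all other edges
are unchanged. -/
def inflateCoeff (Δ : Bigraph n) (a b : Fin n) (i j : Fin n) : ℤ :=
  if (i = a ∧ j = b) ∨ (i = b ∧ j = a) then -Δ.coeff i j
  else if i = b ∧ j ≠ b then Δ.coeff b j - Δ.coeff a j * Δ.coeff a b
  else if j = b ∧ i ≠ b then Δ.coeff b i - Δ.coeff a i * Δ.coeff a b
  else Δ.coeff i j

theorem inflateCoeff_symm (Δ : Bigraph n) (a b i j : Fin n) :
    Δ.inflateCoeff a b i j = Δ.inflateCoeff a b j i := by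
  have h := Δ.coeff_symm i j
  unfold inflateCoeff
  grind

/-- The inflation at the pair `(a, b)`; it is only ever applied when `a ≠ b` are joined by a dotted
edge. -/
def inflate (Δ : Bigraph n) (a b : Fin n) : Bigraph n :=
  ofCoeff (Δ.inflateCoeff a b) (Δ.inflateCoeff_symm a b)

def HasDottedEdge (Δ : Bigraph n) : Prop := ∃ a b, Δ.dotted a b ≠ 0

/-- The dotted edges `a⋯b`, written as pairs `(a, b)` with `a < b`, in lexicographic order. -/
def dottedPairs (Δ : Bigraph n) : Set (Fin n ×ₗ Fin n) :=
  {p | (ofLex p).1 < (ofLex p).2 ∧ Δ.dotted (ofLex p).1 (ofLex p).2 ≠ 0}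

end Bigraph

/-- The four strategies `0, 1, 2, 3` of selecting a dotted edge. -/
inductive Strategy where
  | first
  | last
  | firstOrLast
  | random

namespace Bigraph

variable {n : ℕ}

/-- `Selects s Δ a b`: under the strategy `s` the next inflation applied to `Δ` may be the one at
the pair `(a, b)`. The choices of the randomized strategies are nondeterministic; a random dotted
edge may be selected in either orientation. -/
def Selects : Strategy → Bigraph n → Fin n → Fin n → Prop
  | .first, Δ, a, b => IsLeast Δ.dottedPairs (toLex (a, b))
  | .last, Δ, a, b => IsGreatest Δ.dottedPairs (toLex (a, b))
  | .firstOrLast, Δ, a, b =>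
      IsLeast Δ.dottedPairs (toLex (a, b)) ∨ IsGreatest Δ.dottedPairs (toLex (a, b))
  | .random, Δ, a, b => a ≠ b ∧ Δ.dotted a b ≠ 0

/-- `Execution s Δ k Δ'`: starting from `Δ`, the loop "while there is a dotted edge, select one
with respect to `s` and inflate at it" can arrive at `Δ'` after exactly `k` inflations. -/
inductive Execution (s : Strategy) (Δ : Bigraph n) : ℕ → Bigraph n → Prop
  | start : Execution s Δ 0 Δ
  | step {k : ℕ} {Δ' : Bigraph n} {a b : Fin n} :
      Execution s Δ k Δ' → Δ'.HasDottedEdge → Selects s Δ' a b →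
      Execution s Δ (k + 1) (Δ'.inflate a b)

/-- Some execution stops after exactly `k` inflations and returns `D`. -/
def Returns (s : Strategy) (Δ : Bigraph n) (k : ℕ) (D : Bigraph n) : Prop :=
  Execution s Δ k D ∧ ¬ D.HasDottedEdge

/-- On a loop-free bigraph with a dotted edge every strategy has an edge to select, so that an
execution ends only where the loop condition fails. -/
theorem exists_selects (s : Strategy) (Δ : Bigraph n) (hl : Δ.LoopFree) (h : Δ.HasDottedEdge) :
    ∃ a b, Selects s Δ a b := by
  obtain ⟨a, b, hab⟩ := h
  have hne : a ≠ b := by rintro rfl; exact hab (hl a).2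
  have hS : Δ.dottedPairs.Nonempty := by
    rcases lt_or_gt_of_ne hne with h | h
    · exact ⟨toLex (a, b), h, hab⟩
    · exact ⟨toLex (b, a), h, by rw [Δ.dotted_symm]; exact hab⟩
  have hF : Δ.dottedPairs.Finite :=
    Set.Finite.of_injOn (f := ofLex) (t := Set.univ) (fun _ _ => trivial)
      (ofLex.injective.injOn) Set.finite_univ
  obtain ⟨p, hp, hmin⟩ := hF.exists_minimal hS
  obtain ⟨q, hq, hmax⟩ := hF.exists_maximal hS
  have hleast : IsLeast Δ.dottedPairs p := ⟨hp, fun r hr => (le_total p r).elim id (hmin hr)⟩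
  have hgreat : IsGreatest Δ.dottedPairs q := ⟨hq, fun r hr => (le_total r q).elim id (hmax hr)⟩
  cases s with
  | first => exact ⟨_, _, hleast⟩
  | last => exact ⟨_, _, hgreat⟩
  | firstOrLast => exact ⟨_, _, Or.inl hleast⟩
  | random => exact ⟨a, b, hne, hab⟩

end Bigraph

/-- The path on `n - 1` vertices `0, …, n - 2` with one more vertex `n - 1` joined to the
vertex `p` of the path. -/
def branchGraph (n p : ℕ) : SimpleGraph (Fin n) :=
  SimpleGraph.fromRel fun i j =>
    (i.val + 1 = j.val ∧ j.val + 1 < n) ∨ (i.val = p ∧ j.val + 1 = n)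

/-- The Dynkin graphs `A_n` (`n ≥ 1`), `D_n` (`n ≥ 4`), `E_6`, `E_7`, `E_8` in a standard
labelling. -/
def IsStandardDynkin (n : ℕ) (G : SimpleGraph (Fin n)) : Prop :=
  (1 ≤ n ∧ G = SimpleGraph.pathGraph n) ∨
  (4 ≤ n ∧ G = branchGraph n 1) ∨
  ((n = 6 ∨ n = 7 ∨ n = 8) ∧ G = branchGraph n 2)

namespace Bigraph

variable {n : ℕ}

/-- `D` has no dotted edges and is, up to a relabelling of the vertices, one of the Dynkin
graphs. -/
def IsDynkin (D : Bigraph n) : Prop :=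
  ∃ G : SimpleGraph (Fin n), IsStandardDynkin n G ∧ ∃ σ : Equiv.Perm (Fin n),
    ∀ i j, D.dotted i j = 0 ∧
      (G.Adj (σ i) (σ j) → D.solid i j = 1) ∧ (¬ G.Adj (σ i) (σ j) → D.solid i j = 0)

/-- Whatever choices are made, the loop stops after at most `N` inflations, and the graph it
returns is a Dynkin graph. -/
def EveryRunDynkin (s : Strategy) (Δ : Bigraph n) (N : ℕ) : Prop :=
  (∀ k Δ', Execution s Δ k Δ' → k ≤ N) ∧ ∀ k D, Returns s Δ k D → D.IsDynkin

/-- With suitable choices, the loop stops after at most `N` inflations and returns a Dynkin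
graph. -/
def SomeRunDynkin (s : Strategy) (Δ : Bigraph n) (N : ℕ) : Prop :=
  ∃ k D, k ≤ N ∧ Returns s Δ k D ∧ D.IsDynkin

end Bigraph

/-- The bound on the number of inflations for positive bigraphs. -/
def igPos (n : ℕ) : ℕ :=
  if n = 1 ∨ n = 2 ∨ n = 3 then (n ^ 2 - n) / 2
  else if n = 6 then 30
  else if n = 7 then 56
  else if n = 8 then 112
  else n ^ 2 - 2 * n

/-- The bound on the number of inflations in the presence of a positive sincere root. -/
def igPoss (n : ℕ) : ℕ :=
  if n = 1 ∨ n = 2 ∨ n = 3 then 0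
  else if n = 6 then 5
  else if n = 7 then 10
  else if n = 8 then 21
  else n - 3

/-! Let `B` be the symmetric bilinear form with `B(e_i, e_i) = 2` and `B(e_i, e_j) = d_ij`.
Inflation at `(a, b)` replaces `e_b` by its reflection `e_b - d_ab e_a`, that is, it pulls `B` back
along an invertible shear (`bilin_inflate`). So positivity does not change along a run, nor does
connectedness. As Dynkin graphs are positive, one run that ends in a Dynkin graph already proves
positivity.

Conversely, let the bigraph be positive. Then `d_ab = 1` at each dotted edge, and `x ↦ x + x_b e_a`
embeds the nonnegative roots into those of the inflation, missing `e_b`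
(`Positive.ncard_posRoots_lt`). There are at most `5 ^ n` such roots, so every run stops, at a
connected positive bigraph without dotted edges. That this is a Dynkin graph (`Positive.isDynkin`)
is proved by adding vertices one at a time to a path with one branch vertex; every other way of
attaching a vertex contradicts definiteness.

For the bounds, compare the two ends of a run of length `k`. Initially there are at least the `n`
roots `e_i`, so `n + k` is at most the number of positive roots of the returned Dynkin graph. A
positive sincere root has height at least `n`, stays sincere, and gains height `x_b ≥ 1` at each
step, so `n + k` is at most the largest height of a root. `DynkinBounds` records both numbers,
obtained from lattice embeddings for types A and D and by enumeration inside `E_8` for type E;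
`igPos n + n` and `igPoss n + n` are their maxima over the types of rank `n`. -/

namespace Bigraph

variable {n : ℕ}

/-! ### Inflation as a change of basis -/

/-- The symmetric Gram matrix of a bigraph, with `2`'s on the diagonal. -/
def symGram (Δ : Bigraph n) : Matrix (Fin n) (Fin n) ℤ :=
  Matrix.of fun i j => if i = j then 2 else Δ.coeff i j

theorem symGram_self (Δ : Bigraph n) (i : Fin n) : Δ.symGram i i = 2 := by
  simp [symGram]

theorem symGram_of_ne (Δ : Bigraph n) {i j : Fin n} (h : i ≠ j) :
    Δ.symGram i j = Δ.coeff i j := by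
  simp [symGram, h]

theorem symGram_symm (Δ : Bigraph n) (i j : Fin n) : Δ.symGram i j = Δ.symGram j i := by
  by_cases h : i = j
  · rw [h]
  · rw [symGram_of_ne _ h, symGram_of_ne _ (Ne.symm h), coeff_symm]

/-- The symmetric bilinear form of a bigraph, with values `2` on the standard basis vectors. -/
noncomputable def bilin (R : Type*) [CommRing R] (Δ : Bigraph n) :
    LinearMap.BilinForm R (Fin n → R) :=
  Matrix.toBilin' (Δ.symGram.map (Int.cast : ℤ → R))

section Bilin

variable {R : Type*} [CommRing R]

theorem bilin_single (Δ : Bigraph n) (i j : Fin n) :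
    Δ.bilin R (Pi.single i 1) (Pi.single j 1) = (Δ.symGram i j : R) := by
  simp [bilin, Matrix.toBilin'_single]

theorem bilin_apply (Δ : Bigraph n) (x y : Fin n → R) :
    Δ.bilin R x y = ∑ i, ∑ j, x i * (Δ.symGram i j : R) * y j := by
  simp [bilin, Matrix.toBilin'_apply]

theorem bilin_comm (Δ : Bigraph n) (x y : Fin n → R) : Δ.bilin R x y = Δ.bilin R y x := by
  rw [bilin_apply, bilin_apply, Finset.sum_comm]
  refine Finset.sum_congr rfl fun i _ => Finset.sum_congr rfl fun j _ => ?_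
  rw [Δ.symGram_symm i j]; ring

/-- The symmetric Gram matrix is the sum of the triangular one and its transpose. -/
theorem bilin_self (Δ : Bigraph n) (x : Fin n → R) :
    Δ.bilin R x x = 2 * matrixForm (Δ.gram.map (Int.cast : ℤ → R)) x := by
  have h : matrixForm (Δ.gram.map (Int.cast : ℤ → R)) x
      = ∑ i, ∑ j, x i * (Δ.gram i j : R) * x j := by
    simp [matrixForm, dotProduct, Matrix.mulVec, Finset.mul_sum, mul_assoc]
  have h' : matrixForm (Δ.gram.map (Int.cast : ℤ → R)) x
      = ∑ i, ∑ j, x i * (Δ.gram j i : R) * x j := by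
    rw [h, Finset.sum_comm]
    refine Finset.sum_congr rfl fun i _ => Finset.sum_congr rfl fun j _ => ?_
    ring
  rw [two_mul]
  nth_rw 1 [h]
  rw [h', bilin_apply, ← Finset.sum_add_distrib]
  refine Finset.sum_congr rfl fun i _ => ?_
  rw [← Finset.sum_add_distrib]
  refine Finset.sum_congr rfl fun j _ => ?_
  have : Δ.symGram i j = Δ.gram i j + Δ.gram j i := by
    rcases lt_trichotomy i j with hij | rfl | hij
    · simp [symGram, gram, hij, hij.ne, hij.ne', not_lt.2 hij.le]
    · simp [symGram, gram]
    · simp [symGram, gram, hij, hij.ne, hij.ne', not_lt.2 hij.le, Δ.coeff_symm i j]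
  rw [this]; push_cast; ring

end Bilin

theorem positive_iff (Δ : Bigraph n) :
    Δ.Positive ↔ ∀ x : Fin n → ℝ, x ≠ 0 → 0 < Δ.bilin ℝ x x := by
  unfold Positive
  refine forall₂_congr fun x _ => ?_
  rw [bilin_self]
  constructor <;> intro h <;> linarith

theorem bilin_int (Δ : Bigraph n) (v : Fin n → ℤ) : Δ.bilin ℤ v v = 2 * Δ.form v := by
  rw [bilin_self, form]
  congr 2

theorem Positive.int {Δ : Bigraph n} (h : Δ.Positive) {v : Fin n → ℤ} (hv : v ≠ 0) :
    0 < Δ.bilin ℤ v v := by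
  have hne : (fun i => (v i : ℝ)) ≠ 0 := by
    contrapose! hv
    funext i
    have := congrFun hv i
    simpa using this
  have := Δ.positive_iff.1 h _ hne
  rw [bilin_apply] at this ⊢
  exact_mod_cast this

/-- The substitution `x ↦ x - d x_b e_a`. -/
def shear {R : Type*} [CommRing R] (a b : Fin n) (d : R) : (Fin n → R) →ₗ[R] (Fin n → R) where
  toFun x i := x i - if i = a then d * x b else 0
  map_add' x y := by funext i; simp only [Pi.add_apply]; split_ifs <;> ring
  map_smul' c x := by
    funext i
    simp only [Pi.smul_apply, smul_eq_mul, RingHom.id_apply]; split_ifs <;> ring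

section Shear

variable {R : Type*} [CommRing R]

theorem shear_apply (a b : Fin n) (d : R) (x : Fin n → R) (i : Fin n) :
    shear a b d x i = x i - if i = a then d * x b else 0 := rfl

theorem shear_shear_neg {a b : Fin n} (hab : a ≠ b) (d : R) (x : Fin n → R) :
    shear a b d (shear a b (-d) x) = x := by
  funext i
  simp only [shear_apply, hab.symm, if_false]
  split_ifs <;> ring

theorem shear_neg_shear {a b : Fin n} (hab : a ≠ b) (d : R) (x : Fin n → R) :
    shear a b (-d) (shear a b d x) = x := by
  simpa using shear_shear_neg hab (-d) x

theorem shear_single (a b i : Fin n) (d : R) :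
    shear a b d (Pi.single i 1) =
      (Pi.single i 1 : Fin n → R) - (if i = b then d else 0) • Pi.single a 1 := by
  funext j
  simp only [shear_apply, Pi.sub_apply, Pi.smul_apply, smul_eq_mul, Pi.single_apply]
  grind

end Shear

theorem coeff_inflate (Δ : Bigraph n) (a b i j : Fin n) :
    (Δ.inflate a b).coeff i j = Δ.inflateCoeff a b i j := by
  simp only [inflate, coeff, ofCoeff]
  generalize Δ.inflateCoeff a b i j = z
  omega

theorem symGram_inflate (Δ : Bigraph n) {a b : Fin n} (hab : a ≠ b) (i j : Fin n) :
    (Δ.inflate a b).symGram i j =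
      Δ.symGram i j - (if i = b then Δ.coeff a b else 0) * Δ.symGram a j
        - (if j = b then Δ.coeff a b else 0) * Δ.symGram i a
        + (if i = b then Δ.coeff a b else 0) * (if j = b then Δ.coeff a b else 0) * 2 := by
  have hs := Δ.coeff_symm
  simp only [symGram, Matrix.of_apply, coeff_inflate, inflateCoeff]
  grind

/-- The shear fixes every basis vector except `e_b`, which goes to `e_b - d e_a`; comparing Gram
matrices on the standard basis suffices. -/
theorem bilin_inflate {R : Type*} [CommRing R] (Δ : Bigraph n) {a b : Fin n} (hab : a ≠ b)
    (x y : Fin n → R) :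
    (Δ.inflate a b).bilin R x y =
      Δ.bilin R (shear a b (Δ.coeff a b : R) x) (shear a b (Δ.coeff a b : R) y) := by
  have : (Δ.inflate a b).bilin R =
      (Δ.bilin R).compl₁₂ (shear a b (Δ.coeff a b : R)) (shear a b (Δ.coeff a b : R)) := by
    refine LinearMap.BilinForm.ext_basis (Pi.basisFun R (Fin n)) fun i j => ?_
    rw [Pi.basisFun_apply, Pi.basisFun_apply, bilin_single, symGram_inflate _ hab]
    simp only [LinearMap.compl₁₂_apply, shear_single, map_sub, map_smul, LinearMap.sub_apply,
      LinearMap.smul_apply, bilin_single, symGram_self, smul_eq_mul]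
    push_cast
    ring
  rw [this, LinearMap.compl₁₂_apply]

theorem positive_inflate_iff (Δ : Bigraph n) {a b : Fin n} (hab : a ≠ b) :
    (Δ.inflate a b).Positive ↔ Δ.Positive := by
  rw [positive_iff, positive_iff]
  constructor
  · intro h x hx
    have := h (shear a b (-(Δ.coeff a b : ℝ)) x) fun h0 => hx <| by
      rw [← shear_shear_neg hab (Δ.coeff a b : ℝ) x, h0, map_zero]
    rwa [bilin_inflate _ hab, shear_shear_neg hab] at this
  · intro h x hx
    rw [bilin_inflate _ hab]
    refine h _ fun h0 => hx ?_
    rw [← shear_neg_shear hab (Δ.coeff a b : ℝ) x, h0, map_zero]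

/-! ### Loop-freeness and connectedness along a run -/

theorem LoopFree.inflate {Δ : Bigraph n} (h : Δ.LoopFree) (a b : Fin n) :
    (Δ.inflate a b).LoopFree := by
  intro i
  have h0 : Δ.inflateCoeff a b i i = 0 := by
    have : Δ.coeff i i = 0 := by simp [coeff, h i]
    unfold inflateCoeff
    grind
  simp [Bigraph.inflate, ofCoeff, h0]

theorem underlying_adj (Δ : Bigraph n) (i j : Fin n) :
    Δ.underlying.Adj i j ↔ i ≠ j ∧ Δ.coeff i j ≠ 0 := by
  have := Δ.one_kind i j
  simp only [underlying, coeff]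
  refine and_congr_right fun _ => ?_
  omega

theorem _root_.SimpleGraph.Connected.of_adj_reachable {V : Type*} {G H : SimpleGraph V}
    (hG : G.Connected) (h : ∀ i j, G.Adj i j → H.Reachable i j) : H.Connected := by
  have key : ∀ i j, G.Walk i j → H.Reachable i j := by
    intro i j w
    induction w with
    | nil => exact .refl _
    | cons hadj _ ih => exact (h _ _ hadj).trans ih
  have := hG.nonempty
  exact ⟨fun i j => let ⟨w⟩ := hG.preconnected i j; key i j w⟩

/-- An edge can vanish only between `b` and some `c` with `d_ac ≠ 0`; then the detour from `b` over
`a` to `c` survives. -/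
theorem Connected.inflate {Δ : Bigraph n} (h : Δ.Connected) {a b : Fin n} (hab : a ≠ b)
    (hd : Δ.coeff a b ≠ 0) : (Δ.inflate a b).Connected := by
  have adj (i j : Fin n) (hij : i ≠ j) (hne : Δ.inflateCoeff a b i j ≠ 0) :
      (Δ.inflate a b).underlying.Reachable i j :=
    SimpleGraph.Adj.reachable ((underlying_adj _ _ _).2 ⟨hij, by rwa [coeff_inflate]⟩)
  have hs := Δ.coeff_symm
  have hba : (Δ.inflate a b).underlying.Reachable b a :=
    adj b a hab.symm (by unfold inflateCoeff; grind)
  have hb (c : Fin n) (hcb : c ≠ b) (hc : Δ.coeff b c ≠ 0) :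
      (Δ.inflate a b).underlying.Reachable b c := by
    by_cases hca : c = a
    · rwa [hca]
    by_cases h0 : Δ.coeff a c = 0
    · exact adj b c hcb.symm (by unfold inflateCoeff; grind)
    · exact hba.trans (adj a c (Ne.symm hca) (by unfold inflateCoeff; grind))
  refine SimpleGraph.Connected.of_adj_reachable h fun i j hij => ?_
  obtain ⟨hne, hc⟩ := (underlying_adj _ _ _).1 hij
  by_cases hi : i = b
  · subst hi; exact hb j hne.symm hc
  by_cases hj : j = b
  · subst hj; exact (hb i hne (by rwa [hs])).symm
  · exact adj i j hne (by unfold inflateCoeff; grind)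

theorem Selects.ne {s : Strategy} {Δ : Bigraph n} {a b : Fin n} (h : Selects s Δ a b) :
    a ≠ b ∧ Δ.dotted a b ≠ 0 := by
  have key (h : toLex (a, b) ∈ Δ.dottedPairs) : a ≠ b ∧ Δ.dotted a b ≠ 0 := ⟨ne_of_lt h.1, h.2⟩
  cases s with
  | first => exact key h.1
  | last => exact key h.1
  | firstOrLast => exact h.elim (fun h => key h.1) fun h => key h.1
  | random => exact h

/-! ### Nonnegative roots as a measure of progress -/

theorem coeff_pos {Δ : Bigraph n} {a b : Fin n} (h : Δ.dotted a b ≠ 0) : 0 < Δ.coeff a b := by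
  have := Δ.one_kind a b
  unfold coeff
  omega

/-- The norm `4 - 2 d_ab` of `e_a - e_b` is positive. -/
theorem Positive.coeff_eq_one {Δ : Bigraph n} (hp : Δ.Positive) {a b : Fin n} (hab : a ≠ b)
    (h : Δ.dotted a b ≠ 0) : Δ.coeff a b = 1 := by
  have h0 := coeff_pos h
  have hv : (Pi.single a 1 - Pi.single b 1 : Fin n → ℤ) ≠ 0 := fun h => by
    simpa [hab] using congrFun h a
  have := hp.int hv
  simp only [map_sub, LinearMap.sub_apply, bilin_single, symGram_self, Int.cast_id,
    symGram_of_ne _ hab, symGram_of_ne _ hab.symm, Δ.coeff_symm b a] at this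
  omega

/-- The roots with nonnegative coordinates. -/
def posRoots (Δ : Bigraph n) : Set (Fin n → ℤ) :=
  {x | (∀ i, 0 ≤ x i) ∧ Δ.bilin ℤ x x = 2}

theorem sum_smul_single (x : Fin n → ℤ) : ∑ i, x i • (Pi.single i 1 : Fin n → ℤ) = x := by
  funext j
  simp [Finset.sum_apply, Pi.single_apply]

theorem bilin_eq_sum (Δ : Bigraph n) (y x : Fin n → ℤ) :
    Δ.bilin ℤ y x = ∑ i, x i * Δ.bilin ℤ y (Pi.single i 1) := by
  conv_lhs => rw [← sum_smul_single x]
  simp only [map_sum, map_smul, smul_eq_mul]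

theorem Positive.abs_bilin_single_le {Δ : Bigraph n} (hp : Δ.Positive) {x : Fin n → ℤ}
    (hx : Δ.bilin ℤ x x = 2) (i : Fin n) : |Δ.bilin ℤ x (Pi.single i 1)| ≤ 2 := by
  have nonneg (v : Fin n → ℤ) : 0 ≤ Δ.bilin ℤ v v := by
    by_cases hv : v = 0
    · simp [hv]
    · exact (hp.int hv).le
  have h1 := nonneg (x - Pi.single i 1)
  have h2 := nonneg (x + Pi.single i 1)
  have hc := Δ.bilin_comm x (Pi.single i 1)
  have hs := Δ.symGram_self i
  simp only [map_sub, map_add, LinearMap.sub_apply, LinearMap.add_apply, bilin_single,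
    Int.cast_id] at h1 h2
  rw [abs_le]
  constructor <;> linarith

theorem Positive.eq_of_bilin_single {Δ : Bigraph n} (hp : Δ.Positive) {x y : Fin n → ℤ}
    (h : ∀ i, Δ.bilin ℤ x (Pi.single i 1) = Δ.bilin ℤ y (Pi.single i 1)) : x = y := by
  by_contra hne
  have := hp.int (sub_ne_zero.2 hne)
  rw [bilin_eq_sum] at this
  simp [h] at this

/-- A root is determined by its products with the `n` basis vectors, and each of these lies in `{-2,
…, 2}`. The bound is crude; it only serves termination. -/
theorem Positive.posRoots_subset {Δ : Bigraph n} (hp : Δ.Positive) :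
    Δ.posRoots.Finite ∧ Δ.posRoots.ncard ≤ 5 ^ n := by
  let f : (Fin n → ℤ) → Fin n → ℤ := fun x i => Δ.bilin ℤ x (Pi.single i 1)
  have hinj : Set.InjOn f Δ.posRoots := fun x _ y _ h =>
    hp.eq_of_bilin_single fun i => congrFun h i
  let T : Finset (Fin n → ℤ) := Fintype.piFinset fun _ => Finset.Icc (-2) 2
  have hmaps : Set.MapsTo f Δ.posRoots (T : Set (Fin n → ℤ)) := fun x hx => by
    rw [Finset.mem_coe, Fintype.mem_piFinset]
    exact fun i => Finset.mem_Icc.2 (abs_le.1 (hp.abs_bilin_single_le hx.2 i))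
  refine ⟨Set.Finite.of_injOn hmaps hinj T.finite_toSet, ?_⟩
  calc Δ.posRoots.ncard ≤ (T : Set (Fin n → ℤ)).ncard :=
        Set.ncard_le_ncard_of_injOn f hmaps hinj T.finite_toSet
    _ = 5 ^ n := by rw [Set.ncard_coe_finset, Fintype.card_piFinset]; simp

theorem single_mem_posRoots (Δ : Bigraph n) (i : Fin n) : Pi.single i 1 ∈ Δ.posRoots := by
  refine ⟨fun j => ?_, by rw [bilin_single, symGram_self]; rfl⟩
  rw [Pi.single_apply]; split_ifs <;> simp

theorem single_one_injective :
    Function.Injective fun i : Fin n => (Pi.single i 1 : Fin n → ℤ) := fun i j h => by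
  by_contra hij
  simpa [hij] using congrFun h i

theorem Positive.le_ncard_posRoots {Δ : Bigraph n} (hp : Δ.Positive) : n ≤ Δ.posRoots.ncard := by
  have h := Set.ncard_le_ncard (s := Set.range fun i : Fin n => (Pi.single i 1 : Fin n → ℤ))
    (by rintro _ ⟨i, rfl⟩; exact Δ.single_mem_posRoots i) hp.posRoots_subset.1
  rw [← Set.image_univ, Set.ncard_image_of_injective _ single_one_injective, Set.ncard_univ] at h
  simpa using h

theorem Positive.shear_mem_posRoots {Δ : Bigraph n} (hp : Δ.Positive) {a b : Fin n}
    (hab : a ≠ b) (hd : Δ.dotted a b ≠ 0) {x : Fin n → ℤ} (hx : x ∈ Δ.posRoots) :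
    shear a b (-1) x ∈ (Δ.inflate a b).posRoots := by
  refine ⟨fun i => ?_, ?_⟩
  · have := hx.1 i; have := hx.1 b
    rw [shear_apply]; split_ifs <;> linarith
  · rw [bilin_inflate _ hab, hp.coeff_eq_one hab hd, Int.cast_id, shear_shear_neg hab, hx.2]

theorem Positive.ncard_posRoots_lt {Δ : Bigraph n} (hp : Δ.Positive) {a b : Fin n}
    (hab : a ≠ b) (hd : Δ.dotted a b ≠ 0) :
    Δ.posRoots.ncard < (Δ.inflate a b).posRoots.ncard := by
  have hinj : Function.Injective (shear a b (-1 : ℤ)) :=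
    Function.LeftInverse.injective (g := shear a b 1) fun x => shear_shear_neg hab 1 x
  rw [← Set.ncard_image_of_injective Δ.posRoots hinj]
  refine Set.ncard_lt_ncard ⟨?_, fun hsub => ?_⟩
    ((positive_inflate_iff _ hab).2 hp).posRoots_subset.1
  · rintro _ ⟨x, hx, rfl⟩
    exact hp.shear_mem_posRoots hab hd hx
  -- The only preimage of `e_b` is `e_b - e_a`, which has a negative coordinate.
  · obtain ⟨x, hx, hxe⟩ := hsub ((Δ.inflate a b).single_mem_posRoots b)
    have hxa := congrFun hxe a
    have hxb := congrFun hxe b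
    simp only [shear_apply, if_true, hab.symm, if_false, Pi.single_eq_same,
      Pi.single_eq_of_ne hab] at hxa hxb
    have := hx.1 a
    linarith

theorem Execution.invariants {s : Strategy} {Δ Δ' : Bigraph n} {k : ℕ}
    (h : Execution s Δ k Δ') (hl : Δ.LoopFree) (hc : Δ.Connected) :
    Δ'.LoopFree ∧ Δ'.Connected ∧ (Δ'.Positive ↔ Δ.Positive) := by
  induction h with
  | start => exact ⟨hl, hc, Iff.rfl⟩
  | step _ _ hs ih =>
    obtain ⟨hab, hd⟩ := hs.ne
    exact ⟨ih.1.inflate _ _, ih.2.1.inflate hab (coeff_pos hd).ne',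
      (positive_inflate_iff _ hab).trans ih.2.2⟩

theorem Execution.ncard_posRoots {s : Strategy} {Δ Δ' : Bigraph n} {k : ℕ}
    (h : Execution s Δ k Δ') (hp : Δ.Positive) :
    Δ'.Positive ∧ Δ.posRoots.ncard + k ≤ Δ'.posRoots.ncard := by
  induction h with
  | start => exact ⟨hp, le_rfl⟩
  | step _ _ hs ih =>
    obtain ⟨hab, hd⟩ := hs.ne
    have := ih.1.ncard_posRoots_lt hab hd
    exact ⟨(positive_inflate_iff _ hab).2 ih.1, by omega⟩

/-- Coordinates never decrease under `w ↦ w + w_b e_a`, and the height grows by `w_b ≥ 1`. -/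
theorem Execution.sincere {s : Strategy} {Δ Δ' : Bigraph n} {k : ℕ}
    (h : Execution s Δ k Δ') (hp : Δ.Positive) {v : Fin n → ℤ} (hv : Δ.IsPositiveSincereRoot v) :
    ∃ w ∈ Δ'.posRoots, (∀ i, 1 ≤ w i) ∧ (n + k : ℤ) ≤ ∑ i, w i := by
  induction h with
  | start =>
    have h1 (i : Fin n) : 1 ≤ v i := by
      have := hv.2.1.2 i; have := hv.2.2 i; omega
    refine ⟨v, ⟨hv.2.1.2, by rw [bilin_int, hv.1]; rfl⟩, h1, ?_⟩
    have := Finset.sum_le_sum fun i (_ : i ∈ Finset.univ) => h1 i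
    simpa using this
  | @step k Δ' a b he _ hs ih =>
    obtain ⟨w, hw, hw1, hsum⟩ := ih
    obtain ⟨hab, hd⟩ := hs.ne
    have hb := hw1 b
    refine ⟨shear a b (-1) w, (he.ncard_posRoots hp).1.shear_mem_posRoots hab hd hw,
      fun i => ?_, ?_⟩
    · have := hw1 i
      rw [shear_apply]; split_ifs <;> linarith
    · have : ∑ i, shear a b (-1) w i = ∑ i, w i + w b := by
        simp [shear_apply, Finset.sum_sub_distrib]
      rw [this]; push_cast; linarith

end Bigraph

/-! ### Configurations excluded by definiteness -/

/-- The entries of the symmetric Gram matrix of `branchGraph m p`. -/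
def branchEntry (m p i j : ℕ) : ℤ :=
  if i = j then 2
  else if (i + 1 = j ∧ j + 1 < m) ∨ (i = p ∧ j + 1 = m) ∨ (j + 1 = i ∧ i + 1 < m) ∨
    (j = p ∧ i + 1 = m) then -1
  else 0

theorem branchEntry_nonpos {m p i j : ℕ} (h : i ≠ j) : branchEntry m p i j ≤ 0 := by
  rw [branchEntry, if_neg h]
  split_ifs <;> simp

theorem sum_le_of_nonpos {s : Finset ℕ} {f : ℕ → ℤ} (h : ∀ k ∈ s, f k ≤ 0) {k : ℕ} (hk : k ∈ s) :
    ∑ i ∈ s, f i ≤ f k := by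
  rw [← Finset.add_sum_erase s f hk]
  have := Finset.sum_nonpos fun i (hi : i ∈ s.erase k) => h i (Finset.mem_of_mem_erase hi)
  linarith

theorem sum_le_add_of_nonpos {s : Finset ℕ} {f : ℕ → ℤ} (h : ∀ k ∈ s, f k ≤ 0) {k l : ℕ}
    (hk : k ∈ s) (hl : l ∈ s) (hkl : l ≠ k) : ∑ i ∈ s, f i ≤ f k + f l := by
  rw [← Finset.add_sum_erase s f hk]
  have := sum_le_of_nonpos (fun i (hi : i ∈ s.erase k) => h i (Finset.mem_of_mem_erase hi))
    (Finset.mem_erase.2 ⟨hkl, hl⟩)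
  linarith

/-- `B` is symmetric and positive definite. -/
structure PosDefForm {V : Type*} [AddCommGroup V] (B : LinearMap.BilinForm ℤ V) : Prop where
  symm : ∀ x y, B x y = B y x
  pos : ∀ x, x ≠ 0 → 0 < B x x

namespace PosDefForm

variable {V : Type*} [AddCommGroup V] {B : LinearMap.BilinForm ℤ V}

/-- The functional `l` stands in for linear independence: it is positive on all vectors in play, so
their nontrivial nonnegative combinations are nonzero. -/
theorem pos_of_functional (hB : PosDefForm B) {l : V →ₗ[ℤ] ℤ} {x : V} (hx : 0 < l x) :
    0 < B x x :=
  hB.pos x fun h => by simp [h] at hx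

/-- A vector of norm `2` has product at least `-1` with a vector of norm at most `2`. -/
theorem neg_one_le (hB : PosDefForm B) {l : V →ₗ[ℤ] ℤ} {x w : V} (hx : 0 < l x) (hw : 0 < l w)
    (hxx : B x x = 2) (hww : B w w ≤ 2) : -1 ≤ B x w := by
  have h := hB.pos_of_functional (l := l) (x := x + w) (by rw [map_add]; linarith)
  simp only [map_add, LinearMap.add_apply] at h
  have := hB.symm x w
  linarith

/-- There is no extended Dynkin configuration of type `D`. -/
theorem fork_false (hB : PosDefForm B) {l : V →ₗ[ℤ] ℤ} {u a b c d : V}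
    (hlu : 0 < l u) (hla : 0 < l a) (hlb : 0 < l b) (hlc : 0 < l c) (hld : 0 < l d)
    (huu : B u u ≤ 2) (haa : B a a = 2) (hbb : B b b = 2) (hcc : B c c = 2) (hdd : B d d = 2)
    (hua : B u a ≤ -1) (hub : B u b ≤ -1) (huc : B u c ≤ -1) (hud : B u d ≤ -1)
    (hab : B a b ≤ 0) (hac : B a c ≤ 0) (had : B a d ≤ 0) (hbc : B b c ≤ 0) (hbd : B b d ≤ 0)
    (hcd : B c d ≤ 0) : False := by
  -- The null vector of extended type `D_4`: its norm is at most `4 * 2 + 4 * 2 - 4 * 4 = 0`.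
  have h := hB.pos_of_functional (l := l) (x := u + u + a + b + c + d)
    (by simp only [map_add]; linarith)
  simp only [map_add, LinearMap.add_apply] at h
  have := hB.symm
  linarith [this a u, this b u, this c u, this d u, this b a, this c a, this d a, this c b,
    this d b, this d c]

/-- The vectors `E 0, …, E (m - 1)` have the Gram matrix of `branchGraph m p`, and `l` is positive
on them. -/
structure BranchFamily (B : LinearMap.BilinForm ℤ V) (l : V →ₗ[ℤ] ℤ) (m p : ℕ) (E : ℕ → V) :
    Prop where
  le : p + 2 ≤ m
  gram : ∀ i j, i < m → j < m → B (E i) (E j) = branchEntry m p i j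
  lpos : ∀ i, i < m → 0 < l (E i)

namespace BranchFamily

variable {l : V →ₗ[ℤ] ℤ} {m p : ℕ} {E : ℕ → V}

theorem nonpos (hE : BranchFamily B l m p E) {i j : ℕ} (hi : i < m) (hj : j < m) (h : i ≠ j) :
    B (E i) (E j) ≤ 0 := by
  rw [hE.gram i j hi hj]; exact branchEntry_nonpos h

theorem self (hE : BranchFamily B l m p E) {i : ℕ} (hi : i < m) : B (E i) (E i) = 2 := by
  rw [hE.gram i i hi hi, branchEntry, if_pos rfl]

theorem succ (hE : BranchFamily B l m p E) {i : ℕ} (hi : i + 2 < m) :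
    B (E i) (E (i + 1)) = -1 := by
  rw [hE.gram _ _ (by omega) (by omega)]
  unfold branchEntry
  split_ifs <;> omega

theorem branch (hE : BranchFamily B l m p E) : B (E p) (E (m - 1)) = -1 := by
  have := hE.le
  rw [hE.gram _ _ (by omega) (by omega)]
  unfold branchEntry
  split_ifs <;> omega

theorem lpos_chain (hE : BranchFamily B l m p E) {a b : ℕ} (hab : a ≤ b) (hb : b < m) :
    0 < l (∑ k ∈ Finset.Icc a b, E k) := by
  rw [map_sum]
  refine Finset.sum_pos (fun i hi => hE.lpos i ?_) ⟨a, by simp [hab]⟩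
  have := Finset.mem_Icc.1 hi
  omega

/-- A segment of the path sums to a root of type A: each new vertex has product `-1` with the last
one and `0` with the others. -/
theorem chain_self (hE : BranchFamily B l m p E) (hB : PosDefForm B) {a b : ℕ} (hab : a ≤ b)
    (hb : b + 2 ≤ m) :
    B (∑ k ∈ Finset.Icc a b, E k) (∑ k ∈ Finset.Icc a b, E k) = 2 := by
  induction b, hab using Nat.le_induction with
  | base => simpa using hE.self (by omega)
  | succ b hab ih =>
    have h : B (∑ k ∈ Finset.Icc a b, E k) (E (b + 1)) = -1 := by
      rw [map_sum, LinearMap.sum_apply, Finset.sum_eq_single b, hE.succ (by omega)]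
      · intro k hk hkb
        have := Finset.mem_Icc.1 hk
        rw [hE.gram _ _ (by omega) (by omega)]
        unfold branchEntry
        split_ifs <;> omega
      · simp [hab]
    rw [Finset.sum_Icc_succ_top (by omega)]
    simp only [map_add, LinearMap.add_apply]
    rw [ih (by omega), hB.symm (E (b + 1)), h, hE.self (by omega)]
    rfl

/-- With all products nonpositive, a segment is joined to whatever one of its vertices is joined to.
-/
theorem chain_le (hB : PosDefForm B) {a b k : ℕ} (hk : a ≤ k ∧ k ≤ b) {y : V}
    (hy : ∀ i, a ≤ i → i ≤ b → B y (E i) ≤ 0) :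
    B (∑ i ∈ Finset.Icc a b, E i) y ≤ B y (E k) := by
  rw [hB.symm, map_sum]
  exact sum_le_of_nonpos (fun i hi => hy i (Finset.mem_Icc.1 hi).1 (Finset.mem_Icc.1 hi).2)
    (Finset.mem_Icc.2 hk)

variable {X : V}

/-- A further vector is joined to at most one vertex. -/
theorem unique_neighbor (hE : BranchFamily B l m p E) (hB : PosDefForm B) (hlX : 0 < l X)
    (hX : B X X = 2) (hn : ∀ i, i < m → B X (E i) ≤ 0) {y z : ℕ} (hyz : y < z) (hz : z < m)
    (hy1 : B X (E y) = -1) (hz1 : B X (E z) = -1) : False := by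
  have hp := hE.le
  -- If both neighbours lie on the path, the segment between them is a root whose product with `X`
  -- is at most `-2`.
  by_cases hzm : z + 2 ≤ m
  · have h := hB.neg_one_le hlX (hE.lpos_chain hyz.le hz) hX (hE.chain_self hB hyz.le hzm).le
    rw [map_sum] at h
    have := sum_le_add_of_nonpos (s := Finset.Icc y z) (f := fun i => B X (E i))
      (fun i hi => hn i (by have := Finset.mem_Icc.1 hi; omega))
      (Finset.mem_Icc.2 ⟨le_rfl, hyz.le⟩) (Finset.mem_Icc.2 ⟨hyz.le, le_rfl⟩) hyz.ne'
    linarith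
  · obtain rfl : z = m - 1 := by omega
    -- Here `z` is the branch vertex, and the cycle closes through the segment between `y` and `p`,
    -- in either order.
    set u := ∑ k ∈ Finset.Icc (min y p) (max y p), E k with hu
    have hle : min y p ≤ max y p := by omega
    have hlu : 0 < l u := hE.lpos_chain hle (by omega)
    have huu : B u u = 2 := hE.chain_self hB hle (by omega)
    have hub : B u (E (m - 1)) ≤ -1 := by
      rw [← hE.branch, hB.symm (E p)]
      exact chain_le hB (by omega) fun i _ hi => hE.nonpos (by omega) (by omega) (by omega)
    have hXu : B X u ≤ -1 := by
      rw [← hy1, hB.symm]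
      exact chain_le hB (by omega) fun i _ hi => hn i (by omega)
    have hw : B (u + E (m - 1)) (u + E (m - 1)) ≤ 2 := by
      simp only [map_add, LinearMap.add_apply]
      have := hE.self hz
      have := hB.symm u (E (m - 1))
      linarith
    have h := hB.neg_one_le hlX (w := u + E (m - 1))
      (by rw [map_add]; linarith [hE.lpos _ hz]) hX hw
    rw [map_add] at h
    linarith

/-- A further vector is not joined to an inner vertex of the path if there is a branch. -/
theorem not_inner (hE : BranchFamily B l m p E) (hB : PosDefForm B) (hlX : 0 < l X)
    (hX : B X X = 2) (hn : ∀ i, i < m → B X (E i) ≤ 0) (hp1 : 1 ≤ p) (hp2 : p + 3 ≤ m) {y : ℕ}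
    (hy1 : 1 ≤ y) (hy2 : y + 3 ≤ m) (hy : B X (E y) = -1) : False := by
  have hub {a b : ℕ} (hap : a ≤ p) (hpb : p ≤ b) (hb : b + 2 ≤ m) :
      B (∑ k ∈ Finset.Icc a b, E k) (E (m - 1)) ≤ -1 := by
    rw [← hE.branch, hB.symm (E p)]
    exact chain_le hB ⟨hap, hpb⟩ fun i _ hi => hE.nonpos (by omega) (by omega) (by omega)
  have hux {a b : ℕ} (hap : a ≤ y) (hpb : y ≤ b) (hb : b < m) :
      B (∑ k ∈ Finset.Icc a b, E k) X ≤ -1 := by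
    rw [← hy]
    exact chain_le hB ⟨hap, hpb⟩ fun i _ hi => hn i (by omega)
  have hleft {a b : ℕ} (ha : 1 ≤ a) (hab : a ≤ b) (hb : b + 2 ≤ m) :
      B (∑ k ∈ Finset.Icc a b, E k) (E (a - 1)) ≤ -1 := by
    have := hE.succ (i := a - 1) (by omega)
    rw [Nat.sub_add_cancel ha] at this
    rw [← this]
    exact chain_le hB ⟨le_rfl, hab⟩ fun i hi _ => hE.nonpos (by omega) (by omega) (by omega)
  have hright {a b : ℕ} (hab : a ≤ b) (hb : b + 3 ≤ m) :
      B (∑ k ∈ Finset.Icc a b, E k) (E (b + 1)) ≤ -1 := by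
    rw [← hE.succ (i := b) (by omega), hB.symm (E b)]
    exact chain_le hB ⟨hab, le_rfl⟩ fun i hi _ => hE.nonpos (by omega) (by omega) (by omega)
  have hXs (i : ℕ) (hi : i < m) : B (E i) X ≤ 0 := by rw [hB.symm]; exact hn i hi
  -- A segment containing `p` and `y` is contracted to the centre of a fork; its four arms are the
  -- two path neighbours of the segment, the branch vertex and `X`.
  have key {a b : ℕ} (ha : 1 ≤ a) (hb : b + 3 ≤ m) (hap : a ≤ p) (hpb : p ≤ b) (hay : a ≤ y)
      (hyb : y ≤ b) : False :=
    hB.fork_false (l := l) (u := ∑ k ∈ Finset.Icc a b, E k) (a := E (a - 1)) (b := E (b + 1))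
      (c := E (m - 1)) (d := X) (hE.lpos_chain (by omega) (by omega)) (hE.lpos _ (by omega))
      (hE.lpos _ (by omega)) (hE.lpos _ (by omega)) hlX
      (hE.chain_self hB (by omega) (by omega)).le (hE.self (by omega)) (hE.self (by omega))
      (hE.self (by omega)) hX (hleft ha (by omega) (by omega)) (hright (by omega) hb)
      (hub hap hpb (by omega)) (hux hay hyb (by omega))
      (hE.nonpos (by omega) (by omega) (by omega)) (hE.nonpos (by omega) (by omega) (by omega))
      (hXs _ (by omega)) (hE.nonpos (by omega) (by omega) (by omega)) (hXs _ (by omega))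
      (hXs _ (by omega))
  rcases le_total y p with h | h
  · exact key hy1 hp2 h le_rfl le_rfl h
  · exact key hp1 hy2 le_rfl h h le_rfl

/-- Turns the norm of a vector supported on a subdiagram of fixed size into a closed numerical sum
that `decide` can evaluate. -/
theorem bilin_combination (hE : BranchFamily B l m p E) {k q : ℕ} (c : Fin k → ℤ) (φ : Fin k → ℕ)
    (hφ : ∀ i, φ i < m)
    (h : ∀ i j, branchEntry m p (φ i) (φ j) = branchEntry k q i j) :
    B (∑ i, c i • E (φ i)) (∑ i, c i • E (φ i)) =
      ∑ i, ∑ j, c i * (c j * branchEntry k q i j) := by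
  simp only [map_sum, LinearMap.sum_apply, map_smul, LinearMap.smul_apply, smul_eq_mul]
  simp only [hE.gram _ _ (hφ _) (hφ _), h]
  rw [Finset.sum_comm]
  refine Finset.sum_congr rfl fun i _ => ?_
  rw [Finset.mul_sum]
  refine Finset.sum_congr rfl fun j _ => ?_
  ring

theorem lpos_combination (hE : BranchFamily B l m p E) {k : ℕ} [NeZero k] (c : Fin k → ℤ)
    (φ : Fin k → ℕ) (hφ : ∀ i, φ i < m) (hc : ∀ i, 0 < c i) :
    0 < l (∑ i, c i • E (φ i)) := by
  simp only [map_sum, map_smul, smul_eq_mul]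
  exact Finset.sum_pos (fun i _ => mul_pos (hc i) (hE.lpos _ (hφ i))) ⟨0, Finset.mem_univ _⟩

/-- The branch cannot be prolonged if both other arms have length at least `2`. -/
theorem not_branch_end (hE : BranchFamily B l m p E) (hB : PosDefForm B) (hlX : 0 < l X)
    (hX : B X X = 2) (hn : ∀ i, i < m → B X (E i) ≤ 0) (hp1 : 2 ≤ p) (hp2 : p + 4 ≤ m)
    (hy : B X (E (m - 1)) = -1) : False := by
  -- The five path vertices around `p` and the branch vertex span `E_6`. Its highest root has
  -- coefficient `2` at the branch vertex, so its product with `X` is at most `-2`.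
  let φ : Fin 6 → ℕ := fun i => if i.val < 5 then p - 2 + i else m - 1
  let c : Fin 6 → ℤ := ![1, 2, 3, 2, 1, 2]
  have hφ : ∀ i, φ i < m := fun i => by
    simp only [φ]; split_ifs <;> omega
  have hww := hE.bilin_combination (k := 6) (q := 2) c φ hφ fun i j => by
    have := i.2; have := j.2
    simp only [φ, branchEntry]
    split_ifs <;> omega
  rw [show ∑ i, ∑ j, c i * (c j * branchEntry 6 2 i j) = 2 by decide] at hww
  have h := hB.neg_one_le hlX (hE.lpos_combination c φ hφ (by decide)) hX hww.le
  rw [map_sum, Fin.sum_univ_castSucc] at h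
  have hlast : φ (Fin.last 5) = m - 1 := by simp [φ]
  rw [map_smul, hlast, hy] at h
  have : ∑ i : Fin 5, B X (c i.castSucc • E (φ i.castSucc)) ≤ 0 :=
    Finset.sum_nonpos fun i _ => by
      rw [map_smul]
      have hc : ∀ i, 0 < c i := by decide
      exact mul_nonpos_of_nonneg_of_nonpos (hc _).le (hn _ (hφ _))
  have hc : c (Fin.last 5) = 2 := by decide
  rw [hc] at h
  simp only [smul_eq_mul] at h
  linarith

/-- Otherwise both arms of the path have length at least `3`, giving extended type `E_7`, whose null
vector has norm `0`. -/
theorem arm_le_three (hE : BranchFamily B l m p E) (hB : PosDefForm B) (hp : 3 ≤ p) :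
    m < p + 5 := by
  by_contra! hm
  let φ : Fin 8 → ℕ := fun i => if i.val < 7 then p - 3 + i else m - 1
  let c : Fin 8 → ℤ := ![1, 2, 3, 4, 3, 2, 1, 2]
  have hφ : ∀ i, φ i < m := fun i => by
    simp only [φ]; split_ifs <;> omega
  have hww := hE.bilin_combination (k := 8) (q := 3) c φ hφ fun i j => by
    have := i.2; have := j.2
    simp only [φ, branchEntry]
    split_ifs <;> omega
  rw [show ∑ i, ∑ j, c i * (c j * branchEntry 8 3 i j) = 0 by decide] at hww
  have h := hB.pos_of_functional (hE.lpos_combination c φ hφ (by decide))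
  linarith

/-- Nine vertices would contain extended type `E_8`; the coefficients below are those of its null
vector. -/
theorem card_le_eight (hE : BranchFamily B l m 2 E) (hB : PosDefForm B) : m ≤ 8 := by
  by_contra! hm
  let φ : Fin 9 → ℕ := fun i => if i.val < 8 then i else m - 1
  let c : Fin 9 → ℤ := ![2, 4, 6, 5, 4, 3, 2, 1, 3]
  have hφ : ∀ i, φ i < m := fun i => by
    simp only [φ]; split_ifs <;> omega
  have hww := hE.bilin_combination (k := 9) (q := 2) c φ hφ fun i j => by
    have := i.2; have := j.2
    simp only [φ, branchEntry]
    split_ifs <;> omega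
  rw [show ∑ i, ∑ j, c i * (c j * branchEntry 9 2 i j) = 0 by decide] at hww
  have h := hB.pos_of_functional (hE.lpos_combination c φ hφ (by decide))
  linarith

end BranchFamily

end PosDefForm

/-! ### Growing a branch graph vertex by vertex -/

theorem branchGraph_adj {m p : ℕ} {i j : Fin m} :
    (branchGraph m p).Adj i j ↔ i.val ≠ j.val ∧
      ((i.val + 1 = j.val ∧ j.val + 1 < m) ∨ (i.val = p ∧ j.val + 1 = m) ∨
        (j.val + 1 = i.val ∧ i.val + 1 < m) ∨ (j.val = p ∧ i.val + 1 = m)) := by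
  rw [branchGraph, SimpleGraph.fromRel_adj, Ne, Fin.ext_iff, or_assoc]

/-- The vertices `f 0, …, f (m - 1)` of `G` are distinct and induce `branchGraph m p`. -/
structure IsBranchLabelling {ι : Type*} (G : SimpleGraph ι) (m p : ℕ) (f : Fin m → ι) : Prop where
  inj : Function.Injective f
  adj : ∀ i j, G.Adj (f i) (f j) ↔ (branchGraph m p).Adj i j

/-- The reversal of the path in `branchGraph m p`. -/
def reversePath {m : ℕ} (i : Fin m) : Fin m :=
  ⟨if i.val + 1 < m then m - 2 - i.val else i.val, by have := i.2; split_ifs <;> omega⟩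

theorem reversePath_reversePath {m : ℕ} (i : Fin m) : reversePath (reversePath i) = i := by
  have := i.2
  ext
  simp only [reversePath]
  split_ifs <;> omega

namespace IsBranchLabelling

variable {ι : Type*} {G : SimpleGraph ι} {m p : ℕ} {f : Fin m → ι}

theorem reverse (h : IsBranchLabelling G m p f) (hp : p + 2 ≤ m) :
    IsBranchLabelling G m (m - 2 - p) (f ∘ reversePath) := by
  refine ⟨h.inj.comp (Function.LeftInverse.injective reversePath_reversePath), fun i j => ?_⟩
  have := i.2
  have := j.2
  rw [Function.comp_apply, Function.comp_apply, h.adj, branchGraph_adj, branchGraph_adj]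
  simp only [reversePath]
  split_ifs <;> omega

/-- If the branch and one end of the path are both joined to vertex `1`, they can be
interchanged. -/
theorem swap {a b : Fin m} (h : IsBranchLabelling G m 1 f) (ha : a.val = 0)
    (hb : b.val + 1 = m) (hm : 3 ≤ m) : IsBranchLabelling G m 1 (f ∘ Equiv.swap a b) := by
  refine ⟨h.inj.comp (Equiv.injective _), fun i j => ?_⟩
  have := i.2
  have := j.2
  rw [Function.comp_apply, Function.comp_apply, h.adj, branchGraph_adj, branchGraph_adj]
  simp only [Equiv.swap_apply_def, Fin.ext_iff]
  split_ifs <;> omega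

theorem cons (h : IsBranchLabelling G m p f) (hm : 2 ≤ m) {x : ι} (hx : x ∉ Set.range f)
    (hadj : ∀ i, G.Adj x (f i) ↔ i.val = 0) :
    IsBranchLabelling G (m + 1) (p + 1) (Fin.cons x f : Fin (m + 1) → ι) := by
  refine ⟨Fin.cons_injective_iff.2 ⟨hx, h.inj⟩, fun i j => ?_⟩
  rw [branchGraph_adj]
  refine Fin.cases ?_ (fun i => ?_) i <;> refine Fin.cases ?_ (fun j => ?_) j
  · simp
  · have := j.2
    simp only [Fin.cons_zero, Fin.cons_succ, hadj, Fin.val_zero, Fin.val_succ]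
    omega
  · have := i.2
    simp only [Fin.cons_zero, Fin.cons_succ, G.adj_comm _ x, hadj, Fin.val_zero, Fin.val_succ]
    omega
  · have := i.2
    have := j.2
    simp only [Fin.cons_succ, h.adj, branchGraph_adj, Fin.val_succ]
    omega

/-- The hypothesis on `p` says that the old graph is a path in its given order, so the new vertex
can take over the role of the branch. -/
theorem snoc (h : IsBranchLabelling G m p f) (hp : p + 2 = m ∨ m = 1) {x : ι}
    (hx : x ∉ Set.range f) {y : Fin m} (hadj : ∀ i, G.Adj x (f i) ↔ i = y) :
    IsBranchLabelling G (m + 1) y.val (Fin.snoc f x : Fin (m + 1) → ι) := by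
  refine ⟨Fin.snoc_injective_iff.2 ⟨h.inj, hx⟩, fun i j => ?_⟩
  have := y.2
  rw [branchGraph_adj]
  refine Fin.lastCases ?_ (fun i => ?_) i <;> refine Fin.lastCases ?_ (fun j => ?_) j
  · simp
  · have := j.2
    simp only [Fin.snoc_last, Fin.snoc_castSucc, hadj, Fin.val_last, Fin.val_castSucc,
      Fin.ext_iff, and_true]
    omega
  · have := i.2
    simp only [Fin.snoc_last, Fin.snoc_castSucc, G.adj_comm _ x, hadj, Fin.val_last,
      Fin.val_castSucc, Fin.ext_iff, and_true]
    omega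
  · have := i.2
    have := j.2
    simp only [Fin.snoc_castSucc, h.adj, branchGraph_adj, Fin.val_castSucc]
    omega

end IsBranchLabelling

/-- The vectors `e i` have norm `2` and products `-1` or `0` according to the graph `G`; the
functional `l` is positive on them. -/
structure GraphFamily {V ι : Type*} [AddCommGroup V] (B : LinearMap.BilinForm ℤ V)
    (l : V →ₗ[ℤ] ℤ) (G : SimpleGraph ι) (e : ι → V) : Prop where
  self : ∀ i, B (e i) (e i) = 2
  of_adj : ∀ i j, G.Adj i j → B (e i) (e j) = -1
  of_not_adj : ∀ i j, i ≠ j → ¬ G.Adj i j → B (e i) (e j) = 0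
  lpos : ∀ i, 0 < l (e i)

namespace GraphFamily

variable {V ι : Type*} [AddCommGroup V] {B : LinearMap.BilinForm ℤ V} {l : V →ₗ[ℤ] ℤ}
  {G : SimpleGraph ι} {e : ι → V}

theorem induce (h : GraphFamily B l G e) (s : Set ι) :
    GraphFamily B l (G.induce s) (fun i => e i.1) where
  self _ := h.self _
  of_adj _ _ hij := h.of_adj _ _ hij
  of_not_adj _ _ hij hn := h.of_not_adj _ _ (Subtype.coe_injective.ne hij) hn
  lpos _ := h.lpos _

theorem nonpos (h : GraphFamily B l G e) {i j : ι} (hij : i ≠ j) : B (e i) (e j) ≤ 0 := by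
  by_cases ha : G.Adj i j
  · rw [h.of_adj _ _ ha]; norm_num
  · rw [h.of_not_adj _ _ hij ha]

theorem branchFamily (h : GraphFamily B l G e) {m p : ℕ} {f : Fin m → ι}
    (hf : IsBranchLabelling G m p f) (hp : p + 2 ≤ m) :
    ∃ E : ℕ → V, PosDefForm.BranchFamily B l m p E ∧ ∀ i : Fin m, E i = e (f i) := by
  -- Indexing by `ℕ` allows interval sums and plain index arithmetic; the default `0` is irrelevant.
  refine ⟨fun k => if hk : k < m then e (f ⟨k, hk⟩) else 0, ⟨hp, fun i j hi hj => ?_,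
    fun i hi => ?_⟩, fun i => by simp⟩
  · simp only [hi, hj, dif_pos]
    by_cases hij : i = j
    · subst hij; rw [h.self, branchEntry, if_pos rfl]
    · have hne : f ⟨i, hi⟩ ≠ f ⟨j, hj⟩ := fun h => hij (Fin.ext_iff.1 (hf.inj h))
      have hadj := hf.adj ⟨i, hi⟩ ⟨j, hj⟩
      rw [branchGraph_adj] at hadj
      rw [branchEntry, if_neg hij]
      split_ifs with hc
      · exact h.of_adj _ _ (hadj.2 ⟨hij, hc⟩)
      · exact h.of_not_adj _ _ hne fun ha => hc (hadj.1 ha).2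
  · simpa only [hi, dif_pos] using h.lpos _

/-- Adding a vertex to a branch graph in a positive definite family gives a branch graph. -/
theorem exists_labelling_succ (h : GraphFamily B l G e) (hB : PosDefForm B) {m p : ℕ}
    {f : Fin m → ι} (hf : IsBranchLabelling G m p f) (hp : p + 2 ≤ m ∨ m = 1) {x : ι}
    (hx : x ∉ Set.range f) {y : Fin m} (hy : G.Adj x (f y)) :
    ∃ q, q + 2 ≤ m + 1 ∧ ∃ g : Fin (m + 1) → ι, IsBranchLabelling G (m + 1) q g := by
  have hym := y.2
  rcases hp with hp | rfl
  swap
  · exact ⟨y, by omega, _, hf.snoc (.inr rfl) hx (y := y) fun i => by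
      rw [Subsingleton.elim i y]; simpa using hy⟩
  obtain ⟨E, hE, hEf⟩ := h.branchFamily hf hp
  have hxf (i : Fin m) : x ≠ f i := fun h => hx ⟨i, h.symm⟩
  have hXn (i : ℕ) (hi : i < m) : B (e x) (E i) ≤ 0 := by
    rw [hEf ⟨i, hi⟩]; exact h.nonpos (hxf _)
  have hXadj (i : Fin m) (hi : G.Adj x (f i)) : B (e x) (E i) = -1 := by
    rw [hEf]; exact h.of_adj _ _ hi
  have huniq (i : Fin m) : G.Adj x (f i) ↔ i = y := by
    refine ⟨fun hi => ?_, fun hi => hi ▸ hy⟩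
    by_contra hne
    rcases lt_or_gt_of_ne (fun h => hne (Fin.ext h) : i.val ≠ y.val) with hlt | hlt
    · exact hE.unique_neighbor hB (h.lpos x) (h.self x) hXn hlt y.2 (hXadj i hi) (hXadj y hy)
    · exact hE.unique_neighbor hB (h.lpos x) (h.self x) hXn hlt i.2 (hXadj y hy) (hXadj i hi)
  have hxr : x ∉ Set.range (f ∘ reversePath) := fun ⟨i, hi⟩ => hx ⟨_, hi⟩
  have huniqr (i : Fin m) : G.Adj x ((f ∘ reversePath) i) ↔ i = reversePath y := by
    rw [Function.comp_apply, huniq]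
    constructor
    · rintro rfl; rw [reversePath_reversePath]
    · rintro rfl; rw [reversePath_reversePath]
  -- In this case and the next one the old graph is a path, so `x` becomes the branch; after that,
  -- an end of the path may be prolonged by `x`.
  by_cases hpm : p + 2 = m
  · exact ⟨y, by omega, _, hf.snoc (.inl hpm) hx huniq⟩
  by_cases hp0 : p = 0
  · exact ⟨(reversePath y).val, by have := (reversePath y).2; omega, _,
      (hf.reverse hp).snoc (.inl (by omega)) hxr huniqr⟩
  by_cases hy0 : y.val = 0
  · exact ⟨p + 1, by omega, _, hf.cons (by omega) hx fun i => by
      rw [huniq, Fin.ext_iff, hy0]⟩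
  by_cases hy1 : y.val + 2 = m
  · refine ⟨m - 2 - p + 1, by omega, _, (hf.reverse hp).cons (by omega) hxr fun i => ?_⟩
    rw [huniqr, Fin.ext_iff]
    simp only [reversePath]
    split_ifs <;> omega
  -- Now `x` prolongs the branch. Definiteness leaves only the case that another arm has length `1`;
  -- exchanging that arm with the branch makes `x` an end of the path.
  by_cases hy2 : y.val + 1 = m
  · have key {f' : Fin m → ι} (hf' : IsBranchLabelling G m 1 f') (hx' : x ∉ Set.range f')
        (hu : ∀ i, G.Adj x (f' i) ↔ i = y) :
        ∃ q, q + 2 ≤ m + 1 ∧ ∃ g : Fin (m + 1) → ι, IsBranchLabelling G (m + 1) q g := by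
      refine ⟨2, by omega, _, (hf'.swap (a := ⟨0, by omega⟩) (b := y) rfl hy2 (by omega)).cons
        (x := x) (by omega) (fun ⟨i, hi⟩ => hx' ⟨_, hi⟩) fun i => ?_⟩
      rw [Function.comp_apply, hu, Equiv.swap_apply_eq_iff, Equiv.swap_apply_right, Fin.ext_iff]
    by_cases hp1 : p = 1
    · subst hp1
      exact key hf hx huniq
    by_cases hp2 : p + 3 = m
    · have hr := hf.reverse hp
      rw [show m - 2 - p = 1 by omega] at hr
      refine key hr hxr fun i => ?_
      rw [huniqr, Fin.ext_iff, Fin.ext_iff]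
      simp only [reversePath]
      split_ifs <;> omega
    · refine (hE.not_branch_end hB (h.lpos x) (h.self x) hXn (by omega) (by omega) ?_).elim
      rw [← hy2]; exact hXadj y hy
  · exact (hE.not_inner hB (h.lpos x) (h.self x) hXn (by omega) (by omega) (by omega) (by omega)
      (hXadj y hy)).elim

/-- A connected graph with positive definite form is a branch graph. -/
theorem exists_labelling {m : ℕ} : ∀ {ι : Type} [Fintype ι] {G : SimpleGraph ι} {e : ι → V},
    GraphFamily B l G e → PosDefForm B → G.Connected → Fintype.card ι = m + 1 →
    ∃ p, (p + 2 ≤ m + 1 ∨ m = 0) ∧ ∃ f : Fin (m + 1) → ι, IsBranchLabelling G (m + 1) p f := by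
  induction m with
  | zero =>
    intro ι _ G e h hB hG hc
    obtain ⟨x⟩ := hG.nonempty
    have : Subsingleton (Fin (0 + 1)) := inferInstanceAs (Subsingleton (Fin 1))
    -- For a single vertex the branch position has no meaning; `0` is arbitrary.
    refine ⟨0, .inr rfl, fun _ => x, Function.injective_of_subsingleton _, fun i j => ?_⟩
    rw [Subsingleton.elim i j]
    simp
  | succ m ih =>
    intro ι _ G e h hB hG hc
    classical
    have : Nontrivial ι := Fintype.one_lt_card_iff_nontrivial.1 (by omega)
    -- Induct by removing a vertex whose removal keeps the graph connected.
    obtain ⟨x, hx⟩ := hG.exists_connected_induce_compl_singleton_of_finite_nontrivial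
    have hcard : Fintype.card ({x}ᶜ : Set ι) = m + 1 := by
      rw [Fintype.card_compl_set, hc]; simp
    obtain ⟨p, hp, f, hf⟩ := ih (h.induce _) hB hx hcard
    have hf' : IsBranchLabelling G (m + 1) p (fun i => (f i).1) :=
      ⟨Subtype.coe_injective.comp hf.inj, fun i j => hf.adj i j⟩
    have hbij : Function.Bijective f :=
      (Fintype.bijective_iff_injective_and_card f).2 ⟨hf.inj, by rw [hcard]; simp⟩
    obtain ⟨z, hz⟩ := hG.preconnected.exists_adj_of_nontrivial x
    obtain ⟨y, hy⟩ := hbij.2 ⟨z, hz.ne'⟩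
    obtain ⟨q, hq, g, hg⟩ := h.exists_labelling_succ hB hf' (hp.imp id (by omega)) (x := x)
      (by rintro ⟨i, hi⟩; exact (f i).2 hi) (y := y) (by rw [hy]; exact hz)
    exact ⟨q, .inl hq, g, hg⟩

end GraphFamily

/-! ### Positive bigraphs without dotted edges -/

namespace Bigraph

variable {n : ℕ}

/-- The left arm, of length `p`, is the shorter arm of the path. Length `1` is type D, length `2` is
type E with at most eight vertices, and length `3` or more is excluded by `arm_le_three`. -/
theorem isStandardDynkin_of_le {p : ℕ} {V : Type*} [AddCommGroup V]
    {B : LinearMap.BilinForm ℤ V} {l : V →ₗ[ℤ] ℤ} {E : ℕ → V} (hB : PosDefForm B)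
    (hE : PosDefForm.BranchFamily B l n p E) (hp : p + p + 2 ≤ n) (hp0 : p ≠ 0)
    (hp2 : p + 3 ≤ n) : IsStandardDynkin n (branchGraph n p) := by
  rcases (by omega : p = 1 ∨ p = 2 ∨ 3 ≤ p) with rfl | rfl | h3
  · exact .inr (.inl ⟨by omega, rfl⟩)
  · have := hE.card_le_eight hB
    exact .inr (.inr ⟨by omega, rfl⟩)
  · have := hE.arm_le_three hB h3
    omega

theorem Positive.posDefForm {D : Bigraph n} (hp : D.Positive) : PosDefForm (D.bilin ℤ) :=
  ⟨D.bilin_comm, fun _ => hp.int⟩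

theorem Positive.neg_one_le_coeff {D : Bigraph n} (hp : D.Positive) {i j : Fin n} (hij : i ≠ j) :
    -1 ≤ D.coeff i j := by
  have hv : (Pi.single i 1 + Pi.single j 1 : Fin n → ℤ) ≠ 0 := fun h => by
    simpa [hij] using congrFun h i
  have := hp.int hv
  simp only [map_add, LinearMap.add_apply, bilin_single, symGram_self, Int.cast_id,
    symGram_of_ne _ hij, symGram_of_ne _ hij.symm, D.coeff_symm j i] at this
  omega

theorem Positive.graphFamily {D : Bigraph n} (hp : D.Positive) (hd : ¬ D.HasDottedEdge) :
    GraphFamily (D.bilin ℤ) (∑ i, LinearMap.proj i) D.underlying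
      (fun i => (Pi.single i 1 : Fin n → ℤ)) where
  self i := by rw [bilin_single, symGram_self]; rfl
  of_adj i j h := by
    obtain ⟨hij, hc⟩ := (underlying_adj _ _ _).1 h
    have := hp.neg_one_le_coeff hij
    have h0 : D.dotted i j = 0 := by
      by_contra h; exact hd ⟨i, j, h⟩
    rw [bilin_single, symGram_of_ne _ hij, Int.cast_id]
    unfold coeff at *
    omega
  of_not_adj i j hij h := by
    rw [underlying_adj] at h
    rw [bilin_single, symGram_of_ne _ hij, Int.cast_id]
    tauto
  lpos i := by simp [LinearMap.sum_apply, Pi.single_apply]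

/-- A connected positive bigraph without dotted edges is a Dynkin graph. -/
theorem Positive.isDynkin {D : Bigraph n} (hn : 1 ≤ n) (hp : D.Positive) (hl : D.LoopFree)
    (hc : D.Connected) (hd : ¬ D.HasDottedEdge) : D.IsDynkin := by
  have hG := hp.graphFamily hd
  have hB := hp.posDefForm
  have hd0 (i j : Fin n) : D.dotted i j = 0 := by
    by_contra h; exact hd ⟨i, j, h⟩
  have finish {p : ℕ} {f : Fin n → Fin n} (hf : IsBranchLabelling D.underlying n p f)
      (hs : IsStandardDynkin n (branchGraph n p)) : D.IsDynkin := by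
    let σ : Equiv.Perm (Fin n) := Equiv.ofBijective f (Finite.injective_iff_bijective.1 hf.inj)
    refine ⟨_, hs, σ.symm, fun i j => ⟨hd0 i j, ?_⟩⟩
    rw [← hf.adj, show f (σ.symm i) = i from σ.apply_symm_apply i,
      show f (σ.symm j) = j from σ.apply_symm_apply j, underlying_adj]
    have h0 := hd0 i j
    constructor
    · rintro ⟨hij, h⟩
      have := hp.neg_one_le_coeff hij
      unfold coeff at *
      omega
    · intro h
      by_cases hij : i = j
      · rw [hij, (hl j).1]
      · have : D.coeff i j = 0 := by tauto
        unfold coeff at this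
        omega
  have path {p : ℕ} (h : p + 2 = n ∨ n = 1) : branchGraph n p = SimpleGraph.pathGraph n := by
    ext i j
    have := i.2
    have := j.2
    rw [branchGraph_adj, SimpleGraph.pathGraph_adj]
    omega
  obtain ⟨m, rfl⟩ := Nat.exists_eq_add_of_le' hn
  obtain ⟨p, hpm, f, hf⟩ := hG.exists_labelling hB hc (Fintype.card_fin _)
  -- Reversing the path allows the branch to be placed in its left half; a branch at an end of the
  -- path gives type A.
  have half {p : ℕ} {f : Fin (m + 1) → Fin (m + 1)}
      (hf : IsBranchLabelling D.underlying (m + 1) p f) (hpm : p + 2 ≤ m + 1)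
      (hle : p + p + 2 ≤ m + 1) : D.IsDynkin := by
    by_cases hp0 : p = 0
    · exact finish (hf.reverse hpm) (.inl ⟨hn, path (by omega)⟩)
    obtain ⟨E, hE, -⟩ := hG.branchFamily hf hpm
    by_cases hp2 : p + 3 ≤ m + 1
    · exact finish hf (isStandardDynkin_of_le hB hE hle hp0 hp2)
    · exact finish hf (.inl ⟨hn, path (by omega)⟩)
  rcases hpm with hpm | rfl
  · by_cases hle : p + p + 2 ≤ m + 1
    · exact half hf hpm hle
    · exact half (hf.reverse hpm) (by omega) (by omega)
  · exact finish hf (.inl ⟨hn, path (by omega)⟩)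

end Bigraph

/-! ### Types A and D in standard lattices -/

section Embedding

variable {n m : ℕ} {C : Fin n → Fin n → ℤ} {g : Fin n → Fin m → ℤ} {R : Type*} [CommRing R]

theorem sum_sq_of_gram (hg : ∀ i j, ∑ k, g i k * g j k = C i j) (x : Fin n → R) :
    ∑ k, (∑ i, x i * (g i k : R)) ^ 2 = ∑ i, ∑ j, x i * (C i j : R) * x j := by
  have h (k : Fin m) : (∑ i, x i * (g i k : R)) ^ 2 =
      ∑ i, ∑ j, x i * x j * ((g i k : R) * g j k) := by
    rw [sq, Finset.sum_mul_sum]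
    refine Finset.sum_congr rfl fun i _ => Finset.sum_congr rfl fun j _ => ?_
    ring
  simp only [h]
  rw [Finset.sum_comm]
  refine Finset.sum_congr rfl fun i _ => ?_
  rw [Finset.sum_comm]
  refine Finset.sum_congr rfl fun j _ => ?_
  rw [← Finset.mul_sum, ← hg i j]
  push_cast
  ring

theorem sum_mul_dual {r : Fin m → ℤ} {c : Fin n → ℤ} (hr : ∀ j, ∑ k, r k * g j k = c j)
    (x : Fin n → R) : ∑ k, (r k : R) * ∑ j, x j * (g j k : R) = ∑ j, x j * (c j : R) := by
  simp only [Finset.mul_sum]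
  rw [Finset.sum_comm]
  refine Finset.sum_congr rfl fun j _ => ?_
  rw [← hr j]
  push_cast
  rw [Finset.mul_sum]
  refine Finset.sum_congr rfl fun k _ => ?_
  ring

variable {ω : Fin n → Fin m → ℤ}

/-- The dual vectors recover the coordinates. They are scaled by `2` because some of them are
half-integral in type D. -/
theorem two_mul_eq_sum_dual (hω : ∀ i j, ∑ k, ω i k * g j k = if i = j then 2 else 0)
    (x : Fin n → R) (i : Fin n) : ∑ k, (ω i k : R) * ∑ j, x j * (g j k : R) = 2 * x i := by
  rw [sum_mul_dual (hω i)]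
  simp [mul_comm]

/-- A Gram matrix of linearly independent integral vectors is positive definite. -/
theorem eq_zero_of_gram (hg : ∀ i j, ∑ k, g i k * g j k = C i j)
    (hω : ∀ i j, ∑ k, ω i k * g j k = if i = j then 2 else 0) (x : Fin n → ℝ)
    (hx : ∑ i, ∑ j, x i * (C i j : ℝ) * x j ≤ 0) : x = 0 := by
  rw [← sum_sq_of_gram hg] at hx
  have h0 (k : Fin m) : ∑ i, x i * (g i k : ℝ) = 0 := by
    have := (Finset.sum_eq_zero_iff_of_nonneg fun k _ => sq_nonneg (∑ i, x i * (g i k : ℝ))).1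
      (le_antisymm hx (Finset.sum_nonneg fun k _ => sq_nonneg _)) k (Finset.mem_univ k)
    exact pow_eq_zero_iff two_ne_zero |>.1 this
  funext i
  have := two_mul_eq_sum_dual hω x i
  simp only [h0, mul_zero, Finset.sum_const_zero] at this
  simpa using this.symm

end Embedding

/-- The vector `s ε_a + t ε_b`. -/
def pairVec {m : ℕ} (a b : Fin m) (s t : ℤ) (k : Fin m) : ℤ :=
  (if k = a then s else 0) + if k = b then t else 0

theorem sum_pairVec_mul {m : ℕ} (a b : Fin m) (s t : ℤ) (h : Fin m → ℤ) :
    ∑ k, pairVec a b s t k * h k = s * h a + t * h b := by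
  simp [pairVec, add_mul, Finset.sum_add_distrib]

theorem sum_mul_pairVec {m : ℕ} (a b : Fin m) (s t : ℤ) (h : Fin m → ℤ) :
    ∑ k, h k * pairVec a b s t k = s * h a + t * h b := by
  simp only [mul_comm (h _), sum_pairVec_mul]

theorem sq_eq_one_of_le_two {z : ℤ} (h0 : z ≠ 0) (h : z ^ 2 ≤ 2) : z ^ 2 = 1 := by
  have h1 : z ≤ 1 := by nlinarith
  have h2 : -1 ≤ z := by nlinarith
  obtain rfl | rfl : z = 1 ∨ z = -1 := by omega
  · rfl
  · rfl

/-- The integral vectors of norm `2` are the vectors `± ε_a ± ε_b`. -/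
theorem exists_pairVec {m : ℕ} {w : Fin m → ℤ} (hw : ∑ k, w k ^ 2 = 2) :
    ∃ a b s t, a < b ∧ (s = 1 ∨ s = -1) ∧ (t = 1 ∨ t = -1) ∧ w = pairVec a b s t := by
  have hle (s : Finset (Fin m)) : ∑ k ∈ s, w k ^ 2 ≤ 2 := by
    rw [← hw]
    exact Finset.sum_le_sum_of_subset_of_nonneg (Finset.subset_univ _) fun k _ _ => sq_nonneg _
  have hone {k : Fin m} (hk : w k ≠ 0) : w k ^ 2 = 1 :=
    sq_eq_one_of_le_two hk (by simpa using hle {k})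
  obtain ⟨a, ha⟩ : ∃ a, w a ≠ 0 := by
    by_contra! h
    simp [h] at hw
  obtain ⟨b, hba, hb⟩ : ∃ b, b ≠ a ∧ w b ≠ 0 := by
    by_contra! h
    rw [Finset.sum_eq_single a (fun k _ hk => by simp [h k hk]) (by simp), hone ha] at hw
    norm_num at hw
  have h0 (k : Fin m) (hka : k ≠ a) (hkb : k ≠ b) : w k = 0 := by
    by_contra hk
    have := hle {a, b, k}
    rw [Finset.sum_insert (by simp [hba.symm, hka.symm]), Finset.sum_pair hkb.symm, hone ha,
      hone hb, hone hk] at this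
    norm_num at this
  have heq (c d : Fin m) (hcd : c ≠ d) (h : ∀ k, k ≠ c → k ≠ d → w k = 0) :
      w = pairVec c d (w c) (w d) := by
    funext k
    unfold pairVec
    grind
  rcases lt_or_gt_of_ne hba with hlt | hlt
  · exact ⟨b, a, w b, w a, hlt, sq_eq_one_iff.1 (hone hb), sq_eq_one_iff.1 (hone ha),
      heq b a hlt.ne fun k h1 h2 => h0 k h2 h1⟩
  · exact ⟨a, b, w a, w b, hlt, sq_eq_one_iff.1 (hone ha), sq_eq_one_iff.1 (hone hb),
      heq a b hlt.ne h0⟩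

/-- The roots with nonnegative coordinates of a symmetric matrix with `2`'s on the diagonal. -/
def nonnegRoots {n : ℕ} (C : Fin n → Fin n → ℤ) : Set (Fin n → ℤ) :=
  {x | (∀ i, 0 ≤ x i) ∧ ∑ i, ∑ j, x i * C i j * x j = 2}

/-- What has to be known about the symmetric Gram matrix of a Dynkin graph. -/
structure DynkinBounds {n : ℕ} (C : Fin n → Fin n → ℤ) : Prop where
  eq_zero : ∀ x : Fin n → ℝ, ∑ i, ∑ j, x i * (C i j : ℝ) * x j ≤ 0 → x = 0
  finite : (nonnegRoots C).Finite
  ncard_le : (nonnegRoots C).ncard ≤ igPos n + n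
  height_le : ∀ x ∈ nonnegRoots C, ∑ i, x i ≤ igPoss n + n

theorem ncard_le_of_mapsTo {α β : Type*} {S : Set α} {T : Finset β} {N : ℕ} (f : α → β)
    (hf : ∀ x ∈ S, f x ∈ T) (hinj : Set.InjOn f S) (hT : T.card ≤ N) :
    S.Finite ∧ S.ncard ≤ N := by
  have hm : Set.MapsTo f S (T : Set β) := hf
  refine ⟨Set.Finite.of_injOn hm hinj T.finite_toSet, le_trans ?_ hT⟩
  rw [← Set.ncard_coe_finset]
  exact Set.ncard_le_ncard_of_injOn f hm hinj T.finite_toSet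

section EmbeddingRoots

variable {n m : ℕ} {C : Fin n → Fin n → ℤ} {g ω : Fin n → Fin m → ℤ}

/-- Bounds for a root system that is embedded into a standard lattice by vectors `g` with product
`-1` with `(0, 1, 2, …)`, so that the height of a root is the negative of that product. -/
theorem dynkinBounds_of_gram (hg : ∀ i j, ∑ k, g i k * g j k = C i j)
    (hω : ∀ i j, ∑ k, ω i k * g j k = if i = j then 2 else 0)
    (hρ : ∀ j, ∑ k : Fin m, (k.val : ℤ) * g j k = -1) {T : Finset (Fin m → ℤ)}
    (hT : T.card ≤ igPos n + n)
    (h : ∀ (x : Fin n → ℤ) (a b : Fin m) (s t : ℤ), a < b → (s = 1 ∨ s = -1) →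
      (t = 1 ∨ t = -1) → (fun k => ∑ i, x i * g i k) = pairVec a b s t → 0 < -(s * a + t * b) →
      pairVec a b s t ∈ T ∧ -(s * a + t * b) ≤ igPoss n + n) : DynkinBounds C := by
  have key (x : Fin n → ℤ) (hx : x ∈ nonnegRoots C) :
      (fun k => ∑ i, x i * g i k) ∈ T ∧ ∑ i, x i ≤ igPoss n + n := by
    have h2 := sum_sq_of_gram hg x
    simp only [Int.cast_id] at h2
    obtain ⟨a, b, s, t, hab, hs, ht, hw⟩ := exists_pairVec (h2.trans hx.2)
    have hh := sum_mul_dual hρ x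
    have hw' (k : Fin m) : ∑ j, x j * g j k = pairVec a b s t k := congrFun hw k
    simp only [Int.cast_id, hw', sum_mul_pairVec, mul_neg, mul_one, Finset.sum_neg_distrib] at hh
    have hpos : 0 < ∑ i, x i := by
      refine lt_of_le_of_ne (Finset.sum_nonneg fun i _ => hx.1 i) fun h0 => ?_
      have hz := (Finset.sum_eq_zero_iff_of_nonneg fun i _ => hx.1 i).1 h0.symm
      have := hx.2
      simp [fun i => hz i (Finset.mem_univ i)] at this
    have := h x a b s t hab hs ht hw (by linarith)
    rw [hw]
    exact ⟨this.1, by linarith [this.2]⟩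
  have hinj : Set.InjOn (fun (x : Fin n → ℤ) k => ∑ i, x i * g i k) (nonnegRoots C) := by
    intro x _ y _ hxy
    funext i
    have h1 := two_mul_eq_sum_dual hω x i
    have h2 := two_mul_eq_sum_dual hω y i
    simp only [Int.cast_id, fun k => congrFun hxy k] at h1 h2
    linarith
  have hc := ncard_le_of_mapsTo _ (fun x hx => (key x hx).1) hinj hT
  exact ⟨eq_zero_of_gram hg hω, hc.1, hc.2, fun x hx => (key x hx).2⟩

end EmbeddingRoots

/-- Type `A_n` has `n (n + 1) / 2` positive roots; in ranks `1`, `2`, `3` this is the bound itself,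
from rank `4` on other types have more. -/
theorem gauss_le_igPos (n : ℕ) : ∑ i ∈ Finset.range n, (i + 1) ≤ igPos n + n := by
  have h : (∑ i ∈ Finset.range n, (i + 1)) * 2 = n * (n + 1) := by
    rw [Finset.sum_add_distrib, add_mul, Finset.sum_range_id_mul_two]
    cases n <;> simp; ring
  unfold igPos
  split_ifs with h1
  · rcases h1 with rfl | rfl | rfl <;> simp [Finset.sum_range_succ]
  · subst n; simp [Finset.sum_range_succ]
  · subst n; simp [Finset.sum_range_succ]
  · subst n; simp [Finset.sum_range_succ]
  · rcases Nat.eq_zero_or_pos n with rfl | h0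
    · simp
    · obtain ⟨k, rfl⟩ : ∃ k, n = k + 4 := ⟨n - 4, by omega⟩
      have : (k + 4) ^ 2 - 2 * (k + 4) = k ^ 2 + 6 * k + 8 := by
        rw [Nat.sub_eq_iff_eq_add (by nlinarith)]; ring
      rw [this]
      nlinarith

/-- Simple roots `ε_i - ε_{i+1}` in `ℤ^{n+1}`; the positive roots are `ε_a - ε_b` with `a < b`, of
height `b - a ≤ n`. -/
theorem dynkinBounds_path (n : ℕ) {C : Fin n → Fin n → ℤ}
    (hC : ∀ i j, C i j = if i = j then 2 else
      if i.val + 1 = j.val ∨ j.val + 1 = i.val then -1 else 0) : DynkinBounds C := by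
  refine dynkinBounds_of_gram (m := n + 1) (g := fun i => pairVec i.castSucc i.succ 1 (-1))
    (ω := fun i k => if k.val ≤ i.val then 2 else 0) (fun i j => ?_) (fun i j => ?_) (fun j => ?_)
    (T := Finset.univ.image fun p : Σ i : Fin n, Fin (i.val + 1) =>
      pairVec (p.2.castLE (by omega)) p.1.succ 1 (-1)) ?_ ?_
  · rw [sum_pairVec_mul, hC]
    simp only [pairVec, Fin.ext_iff, Fin.val_castSucc, Fin.val_succ]
    split_ifs <;> omega
  · rw [sum_mul_pairVec]
    simp only [Fin.ext_iff, Fin.val_castSucc, Fin.val_succ]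
    split_ifs <;> omega
  · rw [sum_mul_pairVec]
    simp
  · refine Finset.card_image_le.trans ?_
    rw [Finset.card_univ, Fintype.card_sigma]
    simp only [Fintype.card_fin]
    rw [Fin.sum_univ_eq_sum_range (fun i => i + 1)]
    exact gauss_le_igPos n
  · intro x a b s t hab hs ht hw hpos
    -- Roots have coordinate sum `0`, so the two signs differ, and positive height decides which is
    -- which.
    have hsum := sum_mul_dual (g := fun i => pairVec i.castSucc i.succ 1 (-1))
      (r := fun _ : Fin (n + 1) => (1 : ℤ)) (c := fun _ : Fin n => 0)
      (fun j => by rw [sum_mul_pairVec]; rfl) x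
    have hw' (k : Fin (n + 1)) :
        ∑ j, x j * pairVec j.castSucc j.succ 1 (-1) k = pairVec a b s t k := congrFun hw k
    have h1 := sum_mul_pairVec a b s t fun _ => 1
    simp only [Int.cast_id, hw', mul_zero, Finset.sum_const_zero] at hsum
    rw [hsum] at h1
    have hab' : a.val < b.val := hab
    have hb := b.2
    obtain ⟨rfl, rfl⟩ : s = 1 ∧ t = -1 := by
      rcases hs with rfl | rfl <;> rcases ht with rfl | rfl <;> omega
    refine ⟨Finset.mem_image.2 ⟨⟨⟨b.val - 1, by omega⟩, ⟨a.val, by simp only; omega⟩⟩,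
      Finset.mem_univ _, ?_⟩, by omega⟩
    congr 1
    ext
    simp only [Fin.val_succ]
    omega

/-- Simple roots `ε_i - ε_{i+1}` and, for the branch vertex, `-ε_0 - ε_1`. The positive roots are
`±ε_a - ε_b` with `a < b`, coded by ordered pairs of distinct indices; hence `n (n - 1)` of them. -/
theorem dynkinBounds_fork {n : ℕ} (hn : 4 ≤ n) {C : Fin n → Fin n → ℤ}
    (hC : ∀ i j, C i j = branchEntry n 1 i j) : DynkinBounds C := by
  let z : Fin n := ⟨0, by omega⟩
  let o : Fin n := ⟨1, by omega⟩
  let g : Fin n → Fin n → ℤ := fun i =>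
    if h : i.val + 1 < n then pairVec i ⟨i.val + 1, h⟩ 1 (-1) else pairVec z o (-1) (-1)
  let ω : Fin n → Fin n → ℤ := fun i k =>
    if i.val + 1 = n then -1 else if i.val = 0 then (if k.val = 0 then 1 else -1)
    else if i.val < k.val then -2 else 0
  have hsum (r : Fin n → ℤ) (j : Fin n) : ∑ k, r k * g j k =
      if h : j.val + 1 < n then r j - r ⟨j.val + 1, h⟩ else -r z - r o := by
    simp only [g]
    split_ifs with h <;> rw [sum_mul_pairVec] <;> ring
  refine dynkinBounds_of_gram (g := g) (ω := ω) (fun i j => ?_) (fun i j => ?_) (fun j => ?_)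
    (T := (Finset.univ : Finset (Fin n)).offDiag.image fun p =>
      if p.1 < p.2 then pairVec p.1 p.2 1 (-1) else pairVec p.2 p.1 (-1) (-1)) ?_ ?_
  · have hi := i.2
    have hj := j.2
    rw [hsum, hC]
    simp only [g]
    by_cases h1 : i.val + 1 < n <;> by_cases h2 : j.val + 1 < n <;>
      simp only [h1, h2, dif_pos, dif_neg, not_false_iff, pairVec, Fin.ext_iff, z, o,
        branchEntry, and_true, and_false, false_or] <;> split_ifs <;>
      first | contradiction | omega
  · have hi := i.2
    have hj := j.2
    rw [hsum]
    simp only [ω, z, o, Fin.ext_iff]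
    split_ifs <;> first | contradiction | omega
  · have hj := j.2
    rw [hsum]
    simp only [z, o]
    push_cast
    split_ifs <;> omega
  · refine Finset.card_image_le.trans ?_
    rw [Finset.offDiag_card, Finset.card_univ, Fintype.card_fin]
    unfold igPos
    have : n * n = n ^ 2 := by ring
    split_ifs with h1
    · omega
    · subst n; simp
    · subst n; simp
    · subst n; simp
    · omega
  · intro x a b s t hab hs ht hw hpos
    have hab' : a.val < b.val := hab
    have hb := b.2
    obtain rfl : t = -1 := by
      rcases hs with rfl | rfl <;> rcases ht with rfl | rfl <;> omega
    refine ⟨Finset.mem_image.2 ?_, ?_⟩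
    · rcases hs with rfl | rfl
      · exact ⟨(a, b), by simp [hab.ne], by simp [hab]⟩
      · exact ⟨(b, a), by simp [hab.ne'], by simp [hab.le.not_gt]⟩
    -- The largest height is `(n - 2) + (n - 1) = 2 n - 3`.
    · have : 2 * n ≤ igPoss n + n + 3 := by
        unfold igPoss
        split_ifs <;> omega
      rcases hs with rfl | rfl <;> omega

/-! ### Type E by enumeration of roots -/

/-- The quadratic form (with value `2` on roots) of type `E_8`. -/
def e8Form {R : Type*} [CommRing R] (a b c d e f g h : R) : R :=
  2 * (a ^ 2 + b ^ 2 + c ^ 2 + d ^ 2 + e ^ 2 + f ^ 2 + g ^ 2 + h ^ 2) -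
    2 * (a * b + b * c + c * d + d * e + e * f + f * g + c * h)

theorem e8Form_eq_zero {a b c d e f g h : ℝ} (hq : e8Form a b c d e f g h ≤ 0) :
    a = 0 ∧ b = 0 ∧ c = 0 ∧ d = 0 ∧ e = 0 ∧ f = 0 ∧ g = 0 ∧ h = 0 := by
  -- Half the form, with squares completed along the three arms towards the trivalent vertex `c`;
  -- there remains `1 - 1/3 - 1/4 - 2/5 = 1/60`.
  have key : (a - b / 2) ^ 2 + 3 / 4 * (b - 2 / 3 * c) ^ 2 + (h - c / 2) ^ 2 + (g - f / 2) ^ 2 +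
      3 / 4 * (f - 2 / 3 * e) ^ 2 + 2 / 3 * (e - 3 / 4 * d) ^ 2 + 5 / 8 * (d - 4 / 5 * c) ^ 2 +
      1 / 60 * c ^ 2 ≤ 0 := by
    unfold e8Form at hq
    nlinarith
  have h1 := sq_nonneg (a - b / 2)
  have h2 := sq_nonneg (b - 2 / 3 * c)
  have h3 := sq_nonneg (h - c / 2)
  have h4 := sq_nonneg (g - f / 2)
  have h5 := sq_nonneg (f - 2 / 3 * e)
  have h6 := sq_nonneg (e - 3 / 4 * d)
  have h7 := sq_nonneg (d - 4 / 5 * c)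
  have h8 := sq_nonneg c
  have zero {x : ℝ} (hx : x ^ 2 ≤ 0) : x = 0 :=
    pow_eq_zero_iff two_ne_zero |>.1 (le_antisymm hx (sq_nonneg x))
  have z1 := zero (by linarith : (a - b / 2) ^ 2 ≤ 0)
  have z2 := zero (by linarith : (b - 2 / 3 * c) ^ 2 ≤ 0)
  have z3 := zero (by linarith : (h - c / 2) ^ 2 ≤ 0)
  have z4 := zero (by linarith : (g - f / 2) ^ 2 ≤ 0)
  have z5 := zero (by linarith : (f - 2 / 3 * e) ^ 2 ≤ 0)
  have z6 := zero (by linarith : (e - 3 / 4 * d) ^ 2 ≤ 0)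
  have z7 := zero (by linarith : (d - 4 / 5 * c) ^ 2 ≤ 0)
  have z8 := zero (by linarith : c ^ 2 ≤ 0)
  refine ⟨?_, ?_, ?_, ?_, ?_, ?_, ?_, ?_⟩ <;> linarith

/-- The roots obtained by adding a simple root to a root of type `E_8`. -/
def e8Succ : List ℕ → List (List ℕ)
  | [a, b, c, d, e, f, g, h] =>
    (if b = 2 * a + 1 then [[a + 1, b, c, d, e, f, g, h]] else []) ++
    (if a + c = 2 * b + 1 then [[a, b + 1, c, d, e, f, g, h]] else []) ++
    (if b + d + h = 2 * c + 1 then [[a, b, c + 1, d, e, f, g, h]] else []) ++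
    (if c + e = 2 * d + 1 then [[a, b, c, d + 1, e, f, g, h]] else []) ++
    (if d + f = 2 * e + 1 then [[a, b, c, d, e + 1, f, g, h]] else []) ++
    (if e + g = 2 * f + 1 then [[a, b, c, d, e, f + 1, g, h]] else []) ++
    (if f = 2 * g + 1 then [[a, b, c, d, e, f, g + 1, h]] else []) ++
    (if c = 2 * h + 1 then [[a, b, c, d, e, f, g, h + 1]] else [])
  | _ => []

/-- The positive roots of type `E_8` of height `k + 1`. -/
def e8Level : ℕ → List (List ℕ)
  | 0 => [[1, 0, 0, 0, 0, 0, 0, 0], [0, 1, 0, 0, 0, 0, 0, 0], [0, 0, 1, 0, 0, 0, 0, 0],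
      [0, 0, 0, 1, 0, 0, 0, 0], [0, 0, 0, 0, 1, 0, 0, 0], [0, 0, 0, 0, 0, 1, 0, 0],
      [0, 0, 0, 0, 0, 0, 1, 0], [0, 0, 0, 0, 0, 0, 0, 1]]
  | k + 1 => ((e8Level k).flatMap e8Succ).dedup

/-- Since `∑ x_i B(x, e_i) = 2`, some `x_i ≥ 1` has `B(x, e_i) ≥ 1`. Above height `1`, `x - e_i` is
nonzero of norm `4 - 2 B(x, e_i)`, so it is a root, of product `-1` with `e_i`; this is the
condition tested by `e8Succ`. -/
theorem mem_e8Level : ∀ (k a b c d e f g h : ℕ), a + b + c + d + e + f + g + h = k + 1 →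
    e8Form (a : ℤ) b c d e f g h = 2 → [a, b, c, d, e, f, g, h] ∈ e8Level k := by
  intro k
  induction k with
  | zero =>
    intro a b c d e f g h hs _
    have : (a = 1 ∨ b = 1 ∨ c = 1 ∨ d = 1 ∨ e = 1 ∨ f = 1 ∨ g = 1 ∨ h = 1) := by omega
    rcases this with rfl | rfl | rfl | rfl | rfl | rfl | rfl | rfl <;>
    · simp only [e8Level, List.mem_cons, List.cons.injEq]
      simp
      omega
  | succ k ih =>
    intro a b c d e f g h hs hq
    have small (a b c d e f g h : ℕ) (hs : a + b + c + d + e + f + g + h = k + 1) :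
        0 < e8Form (a : ℤ) b c d e f g h := by
      by_contra! hle
      have : e8Form (a : ℝ) b c d e f g h ≤ 0 := by
        have := hle
        simp only [e8Form] at this ⊢
        exact_mod_cast this
      obtain ⟨h1, h2, h3, h4, h5, h6, h7, h8⟩ := e8Form_eq_zero this
      norm_cast at h1 h2 h3 h4 h5 h6 h7 h8
      omega
    have step {u v : List ℕ} (hu : u ∈ e8Level k) (hv : v ∈ e8Succ u) : v ∈ e8Level (k + 1) := by
      rw [e8Level, List.mem_dedup, List.mem_flatMap]
      exact ⟨u, hu, hv⟩
    have hsum : (a : ℤ) * (2 * a - b) + b * (2 * b - a - c) + c * (2 * c - b - d - h) +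
        d * (2 * d - c - e) + e * (2 * e - d - f) + f * (2 * f - e - g) + g * (2 * g - f) +
        h * (2 * h - c) = 2 := by
      refine Eq.trans ?_ hq
      rw [e8Form]; ring
    have hex : (1 ≤ a ∧ b < 2 * a) ∨ (1 ≤ b ∧ a + c < 2 * b) ∨ (1 ≤ c ∧ b + d + h < 2 * c) ∨
        (1 ≤ d ∧ c + e < 2 * d) ∨ (1 ≤ e ∧ d + f < 2 * e) ∨ (1 ≤ f ∧ e + g < 2 * f) ∨
        (1 ≤ g ∧ f < 2 * g) ∨ (1 ≤ h ∧ c < 2 * h) := by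
      by_contra! hcon
      obtain ⟨h1, h2, h3, h4, h5, h6, h7, h8⟩ := hcon
      have nonpos {x : ℕ} {y : ℤ} (hy : 1 ≤ x → y ≤ 0) : (x : ℤ) * y ≤ 0 := by
        rcases Nat.eq_zero_or_pos x with rfl | hx
        · simp
        · exact mul_nonpos_of_nonneg_of_nonpos (by omega) (hy hx)
      have := nonpos (x := a) (y := 2 * a - b) (by omega)
      have := nonpos (x := b) (y := 2 * b - a - c) (by omega)
      have := nonpos (x := c) (y := 2 * c - b - d - h) (by omega)
      have := nonpos (x := d) (y := 2 * d - c - e) (by omega)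
      have := nonpos (x := e) (y := 2 * e - d - f) (by omega)
      have := nonpos (x := f) (y := 2 * f - e - g) (by omega)
      have := nonpos (x := g) (y := 2 * g - f) (by omega)
      have := nonpos (x := h) (y := 2 * h - c) (by omega)
      linarith
    rcases hex with ⟨h0, h1⟩ | ⟨h0, h1⟩ | ⟨h0, h1⟩ | ⟨h0, h1⟩ | ⟨h0, h1⟩ | ⟨h0, h1⟩ | ⟨h0, h1⟩ |
      ⟨h0, h1⟩
    · obtain ⟨x, rfl⟩ := Nat.exists_eq_add_of_le' h0
      have hp := small x b c d e f g h (by omega)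
      have hd : e8Form ((x + 1 : ℕ) : ℤ) b c d e f g h =
          e8Form (x : ℤ) b c d e f g h + 2 * (2 * x - b) + 2 := by
        simp only [e8Form]; push_cast; ring
      exact step (ih x b c d e f g h (by omega) (by omega))
        (by simp [e8Succ, show b = 2 * x + 1 by omega])
    · obtain ⟨x, rfl⟩ := Nat.exists_eq_add_of_le' h0
      have hp := small a x c d e f g h (by omega)
      have hd : e8Form (a : ℤ) (x + 1 : ℕ) c d e f g h =
          e8Form (a : ℤ) x c d e f g h + 2 * (2 * x - a - c) + 2 := by
        simp only [e8Form]; push_cast; ring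
      exact step (ih a x c d e f g h (by omega) (by omega))
        (by simp [e8Succ, show a + c = 2 * x + 1 by omega])
    · obtain ⟨x, rfl⟩ := Nat.exists_eq_add_of_le' h0
      have hp := small a b x d e f g h (by omega)
      have hd : e8Form (a : ℤ) b (x + 1 : ℕ) d e f g h =
          e8Form (a : ℤ) b x d e f g h + 2 * (2 * x - b - d - h) + 2 := by
        simp only [e8Form]; push_cast; ring
      exact step (ih a b x d e f g h (by omega) (by omega))
        (by simp [e8Succ, show b + d + h = 2 * x + 1 by omega])
    · obtain ⟨x, rfl⟩ := Nat.exists_eq_add_of_le' h0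
      have hp := small a b c x e f g h (by omega)
      have hd : e8Form (a : ℤ) b c (x + 1 : ℕ) e f g h =
          e8Form (a : ℤ) b c x e f g h + 2 * (2 * x - c - e) + 2 := by
        simp only [e8Form]; push_cast; ring
      exact step (ih a b c x e f g h (by omega) (by omega))
        (by simp [e8Succ, show c + e = 2 * x + 1 by omega])
    · obtain ⟨x, rfl⟩ := Nat.exists_eq_add_of_le' h0
      have hp := small a b c d x f g h (by omega)
      have hd : e8Form (a : ℤ) b c d (x + 1 : ℕ) f g h =
          e8Form (a : ℤ) b c d x f g h + 2 * (2 * x - d - f) + 2 := by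
        simp only [e8Form]; push_cast; ring
      exact step (ih a b c d x f g h (by omega) (by omega))
        (by simp [e8Succ, show d + f = 2 * x + 1 by omega])
    · obtain ⟨x, rfl⟩ := Nat.exists_eq_add_of_le' h0
      have hp := small a b c d e x g h (by omega)
      have hd : e8Form (a : ℤ) b c d e (x + 1 : ℕ) g h =
          e8Form (a : ℤ) b c d e x g h + 2 * (2 * x - e - g) + 2 := by
        simp only [e8Form]; push_cast; ring
      exact step (ih a b c d e x g h (by omega) (by omega))
        (by simp [e8Succ, show e + g = 2 * x + 1 by omega])
    · obtain ⟨x, rfl⟩ := Nat.exists_eq_add_of_le' h0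
      have hp := small a b c d e f x h (by omega)
      have hd : e8Form (a : ℤ) b c d e f (x + 1 : ℕ) h =
          e8Form (a : ℤ) b c d e f x h + 2 * (2 * x - f) + 2 := by
        simp only [e8Form]; push_cast; ring
      exact step (ih a b c d e f x h (by omega) (by omega))
        (by simp [e8Succ, show f = 2 * x + 1 by omega])
    · obtain ⟨x, rfl⟩ := Nat.exists_eq_add_of_le' h0
      have hp := small a b c d e f g x (by omega)
      have hd : e8Form (a : ℤ) b c d e f g (x + 1 : ℕ) =
          e8Form (a : ℤ) b c d e f g x + 2 * (2 * x - c) + 2 := by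
        simp only [e8Form]; push_cast; ring
      exact step (ih a b c d e f g x (by omega) (by omega))
        (by simp [e8Succ, show c = 2 * x + 1 by omega])

/-- The positive roots of type `E_8`. -/
def e8Roots : List (List ℕ) := (List.range 29).flatMap e8Level

theorem e8Level_eq_nil {k : ℕ} (hk : 29 ≤ k) : e8Level k = [] := by
  induction k, hk using Nat.le_induction with
  -- Level `29` would hold the roots of height `30`; an empty level stays empty.
  | base => decide +kernel
  | succ k _ ih => rw [e8Level, ih]; rfl

theorem mem_e8Roots {a b c d e f g h : ℕ} (hq : e8Form (a : ℤ) b c d e f g h = 2) :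
    [a, b, c, d, e, f, g, h] ∈ e8Roots := by
  obtain ⟨k, hk⟩ : ∃ k, a + b + c + d + e + f + g + h = k + 1 := by
    refine Nat.exists_eq_succ_of_ne_zero fun h0 => ?_
    obtain ⟨rfl, rfl, rfl, rfl, rfl, rfl, rfl, rfl⟩ : a = 0 ∧ b = 0 ∧ c = 0 ∧ d = 0 ∧ e = 0 ∧
        f = 0 ∧ g = 0 ∧ h = 0 := by omega
    simp [e8Form] at hq
  have hm := mem_e8Level k a b c d e f g h hk hq
  have hlt : k < 29 := by
    by_contra! hle
    rw [e8Level_eq_nil hle] at hm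
    cases hm
  exact List.mem_flatMap.2 ⟨k, List.mem_range.2 hlt, hm⟩

theorem e8Roots_bounds : e8Roots.length = 120 ∧ ∀ r ∈ e8Roots, r.sum ≤ 29 := by
  decide +kernel

/-- The roots of `E_7` and `E_6` are the roots of `E_8` that vanish on the last one or two vertices
of the long arm. -/
theorem e7Roots_bounds : (e8Roots.filter fun r => r.getD 6 0 = 0).length = 63 ∧
    ∀ r ∈ e8Roots.filter fun r => r.getD 6 0 = 0, r.sum ≤ 17 := by
  decide +kernel

theorem e6Roots_bounds : (e8Roots.filter fun r => r.getD 5 0 = 0 ∧ r.getD 6 0 = 0).length = 36 ∧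
    ∀ r ∈ e8Roots.filter fun r => r.getD 5 0 = 0 ∧ r.getD 6 0 = 0, r.sum ≤ 11 := by
  decide +kernel

/-- In the applications `φ` pads a coordinate vector with zeros to one of type `E_8`, without
changing its height. -/
theorem dynkinBounds_of_list {n : ℕ} {C : Fin n → Fin n → ℤ}
    (h0 : ∀ x : Fin n → ℝ, ∑ i, ∑ j, x i * (C i j : ℝ) * x j ≤ 0 → x = 0)
    (φ : (Fin n → ℕ) → List ℕ) (hφ : Function.Injective φ) (hs : ∀ y, (φ y).sum = ∑ i, y i)
    {L : List (List ℕ)} (hL : L.length ≤ igPos n + n) (hmax : ∀ r ∈ L, r.sum ≤ igPoss n + n)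
    (h : ∀ y : Fin n → ℕ, ∑ i, ∑ j, (y i : ℤ) * C i j * y j = 2 → φ y ∈ L) : DynkinBounds C := by
  have lift (x : Fin n → ℤ) (hx : x ∈ nonnegRoots C) :
      (fun i => ((x i).toNat : ℤ)) = x := funext fun i => Int.toNat_of_nonneg (hx.1 i)
  have hmem (x : Fin n → ℤ) (hx : x ∈ nonnegRoots C) : φ (fun i => (x i).toNat) ∈ L := by
    refine h _ ?_
    have hl (i : Fin n) := congrFun (lift x hx) i
    simp only [hl]
    exact hx.2
  have hc := ncard_le_of_mapsTo (S := nonnegRoots C) (T := L.toFinset)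
    (fun x => φ fun i => (x i).toNat) (fun x hx => List.mem_toFinset.2 (hmem x hx))
    (fun x hx y hy hxy => by
      rw [← lift x hx, ← lift y hy]
      funext i
      exact congrArg Nat.cast (congrFun (hφ hxy) i)) (L.toFinset_card_le.trans hL)
  refine ⟨h0, hc.1, hc.2, fun x hx => ?_⟩
  have := hmax _ (hmem x hx)
  rw [hs] at this
  rw [← Finset.sum_congr rfl fun i _ => congrFun (lift x hx) i]
  exact_mod_cast this

theorem dynkinBounds_e8 {C : Fin 8 → Fin 8 → ℤ} (hC : ∀ i j, C i j = branchEntry 8 2 i j) :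
    DynkinBounds C := by
  have hform (R : Type) [CommRing R] (x : Fin 8 → R) : ∑ i, ∑ j, x i * (C i j : R) * x j =
      e8Form (x 0) (x 1) (x 2) (x 3) (x 4) (x 5) (x 6) (x 7) := by
    simp [hC, Fin.sum_univ_eight, branchEntry, e8Form]
    ring
  refine dynkinBounds_of_list (fun x hx => ?_) (fun y => [y 0, y 1, y 2, y 3, y 4, y 5, y 6, y 7])
    (fun y y' h => ?_) (fun y => ?_) (L := e8Roots) e8Roots_bounds.1.le e8Roots_bounds.2
    fun y hy => ?_
  · rw [hform] at hx
    obtain ⟨h1, h2, h3, h4, h5, h6, h7, h8⟩ := e8Form_eq_zero hx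
    funext i
    fin_cases i <;> assumption
  · simp only [List.cons.injEq, and_true] at h
    obtain ⟨h1, h2, h3, h4, h5, h6, h7, h8⟩ := h
    funext i
    fin_cases i <;> assumption
  · simp [Fin.sum_univ_eight, add_assoc]
  · have := hform ℤ fun i => (y i : ℤ)
    simp only [Int.cast_id, hy] at this
    exact mem_e8Roots this.symm

theorem dynkinBounds_e7 {C : Fin 7 → Fin 7 → ℤ} (hC : ∀ i j, C i j = branchEntry 7 2 i j) :
    DynkinBounds C := by
  have hform (R : Type) [CommRing R] (x : Fin 7 → R) : ∑ i, ∑ j, x i * (C i j : R) * x j =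
      e8Form (x 0) (x 1) (x 2) (x 3) (x 4) (x 5) 0 (x 6) := by
    simp [hC, Fin.sum_univ_seven, branchEntry, e8Form]
    ring
  refine dynkinBounds_of_list (fun x hx => ?_) (fun y => [y 0, y 1, y 2, y 3, y 4, y 5, 0, y 6])
    (fun y y' h => ?_) (fun y => ?_) e7Roots_bounds.1.le e7Roots_bounds.2 fun y hy => ?_
  · rw [hform] at hx
    obtain ⟨h1, h2, h3, h4, h5, h6, -, h7⟩ := e8Form_eq_zero hx
    funext i
    fin_cases i <;> assumption
  · simp only [List.cons.injEq, and_true, true_and] at h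
    obtain ⟨h1, h2, h3, h4, h5, h6, h7⟩ := h
    funext i
    fin_cases i <;> assumption
  · simp [Fin.sum_univ_seven, add_assoc]
  · have := hform ℤ fun i => (y i : ℤ)
    simp only [Int.cast_id, hy] at this
    exact List.mem_filter.2 ⟨mem_e8Roots (by rw [this]; norm_num), by simp⟩

theorem dynkinBounds_e6 {C : Fin 6 → Fin 6 → ℤ} (hC : ∀ i j, C i j = branchEntry 6 2 i j) :
    DynkinBounds C := by
  have hform (R : Type) [CommRing R] (x : Fin 6 → R) : ∑ i, ∑ j, x i * (C i j : R) * x j =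
      e8Form (x 0) (x 1) (x 2) (x 3) (x 4) 0 0 (x 5) := by
    simp [hC, Fin.sum_univ_six, branchEntry, e8Form]
    ring
  refine dynkinBounds_of_list (fun x hx => ?_) (fun y => [y 0, y 1, y 2, y 3, y 4, 0, 0, y 5])
    (fun y y' h => ?_) (fun y => ?_) e6Roots_bounds.1.le e6Roots_bounds.2 fun y hy => ?_
  · rw [hform] at hx
    obtain ⟨h1, h2, h3, h4, h5, -, -, h6⟩ := e8Form_eq_zero hx
    funext i
    fin_cases i <;> assumption
  · simp only [List.cons.injEq, and_true, true_and] at h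
    obtain ⟨h1, h2, h3, h4, h5, h6⟩ := h
    funext i
    fin_cases i <;> assumption
  · simp [Fin.sum_univ_six, add_assoc]
  · have := hform ℤ fun i => (y i : ℤ)
    simp only [Int.cast_id, hy] at this
    exact List.mem_filter.2 ⟨mem_e8Roots (by rw [this]; norm_num), by simp⟩

/-! ### Bounds for arbitrary Dynkin graphs -/

/-- The symmetric Gram matrix of a graph. -/
noncomputable def graphGram {n : ℕ} (G : SimpleGraph (Fin n)) (i j : Fin n) : ℤ :=
  open Classical in if i = j then 2 else if G.Adj i j then -1 else 0

theorem graphGram_branchGraph {n p : ℕ} (i j : Fin n) :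
    graphGram (branchGraph n p) i j = branchEntry n p i j := by
  unfold graphGram branchEntry
  simp only [branchGraph_adj, Fin.ext_iff]
  split_ifs <;> tauto

theorem IsStandardDynkin.bounds {n : ℕ} {G : SimpleGraph (Fin n)} (h : IsStandardDynkin n G) :
    DynkinBounds (graphGram G) := by
  rcases h with ⟨-, rfl⟩ | ⟨hn, rfl⟩ | ⟨rfl | rfl | rfl, rfl⟩
  · refine dynkinBounds_path n fun i j => ?_
    simp only [graphGram, SimpleGraph.pathGraph_adj]
  · exact dynkinBounds_fork hn graphGram_branchGraph
  · exact dynkinBounds_e6 graphGram_branchGraph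
  · exact dynkinBounds_e7 graphGram_branchGraph
  · exact dynkinBounds_e8 graphGram_branchGraph

namespace Bigraph

variable {n : ℕ}

theorem IsDynkin.exists_gram {D : Bigraph n} (h : D.IsDynkin) :
    ∃ C : Fin n → Fin n → ℤ, DynkinBounds C ∧ ∃ σ : Equiv.Perm (Fin n),
      ∀ i j, D.symGram i j = C (σ i) (σ j) := by
  obtain ⟨G, hG, σ, hσ⟩ := h
  refine ⟨graphGram G, hG.bounds, σ, fun i j => ?_⟩
  obtain ⟨h0, h1, h2⟩ := hσ i j
  unfold graphGram
  by_cases hij : i = j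
  · simp [hij, symGram_self]
  rw [symGram_of_ne _ hij, coeff, h0, if_neg (σ.injective.ne hij)]
  by_cases hadj : G.Adj (σ i) (σ j)
  · rw [if_pos hadj, h1 hadj]; rfl
  · rw [if_neg hadj, h2 hadj]; rfl

theorem bilin_eq_of_gram {R : Type*} [CommRing R] {D : Bigraph n} {C : Fin n → Fin n → ℤ}
    {σ : Equiv.Perm (Fin n)} (hσ : ∀ i j, D.symGram i j = C (σ i) (σ j)) (x : Fin n → R) :
    D.bilin R x x = ∑ i, ∑ j, (x ∘ σ.symm) i * (C i j : R) * (x ∘ σ.symm) j := by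
  rw [bilin_apply]
  conv_rhs => rw [← Equiv.sum_comp σ]
  refine Finset.sum_congr rfl fun i _ => ?_
  conv_rhs => rw [← Equiv.sum_comp σ]
  refine Finset.sum_congr rfl fun j _ => ?_
  simp [hσ]

theorem IsDynkin.positive {D : Bigraph n} (h : D.IsDynkin) : D.Positive := by
  obtain ⟨C, hC, σ, hσ⟩ := h.exists_gram
  rw [positive_iff]
  intro x hx
  by_contra! hle
  rw [bilin_eq_of_gram hσ] at hle
  refine hx (funext fun i => ?_)
  simpa using congrFun (hC.eq_zero _ hle) (σ i)

theorem comp_symm_mem_nonnegRoots {D : Bigraph n} {C : Fin n → Fin n → ℤ}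
    {σ : Equiv.Perm (Fin n)} (hσ : ∀ i j, D.symGram i j = C (σ i) (σ j)) {x : Fin n → ℤ}
    (hx : x ∈ D.posRoots) : x ∘ σ.symm ∈ nonnegRoots C := by
  refine ⟨fun i => hx.1 _, ?_⟩
  have := bilin_eq_of_gram hσ x
  rw [hx.2] at this
  exact this.symm

theorem IsDynkin.ncard_posRoots_le {D : Bigraph n} (h : D.IsDynkin) :
    D.posRoots.ncard ≤ igPos n + n := by
  obtain ⟨C, hC, σ, hσ⟩ := h.exists_gram
  refine le_trans ?_ hC.ncard_le
  refine Set.ncard_le_ncard_of_injOn (fun x => x ∘ σ.symm)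
    (fun x hx => comp_symm_mem_nonnegRoots hσ hx) (fun x _ y _ hxy => ?_) hC.finite
  exact σ.symm.surjective.injective_comp_right hxy

theorem IsDynkin.sum_le {D : Bigraph n} (h : D.IsDynkin) {x : Fin n → ℤ} (hx : x ∈ D.posRoots) :
    ∑ i, x i ≤ igPoss n + n := by
  obtain ⟨C, hC, σ, hσ⟩ := h.exists_gram
  have := hC.height_le _ (comp_symm_mem_nonnegRoots hσ hx)
  rwa [← Equiv.sum_comp σ.symm x]

/-! ### Termination and the equivalences -/

/-- If the lengths of executions are bounded then every execution can be completed. -/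
theorem Execution.exists_returns {s : Strategy} {Δ : Bigraph n} (hl : Δ.LoopFree)
    (hc : Δ.Connected) {N : ℕ} (hN : ∀ k Δ', Execution s Δ k Δ' → k ≤ N) {k : ℕ}
    {Δ' : Bigraph n} (h : Execution s Δ k Δ') : ∃ k' D, k ≤ k' ∧ Returns s Δ k' D := by
  induction hr : N - k generalizing k Δ' with
  | zero =>
    by_cases hd : Δ'.HasDottedEdge
    · obtain ⟨a, b, hab⟩ := exists_selects s Δ' (h.invariants hl hc).1 hd
      have := hN _ _ (h.step hd hab)
      omega
    · exact ⟨k, Δ', le_rfl, h, hd⟩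
  | succ r ih =>
    by_cases hd : Δ'.HasDottedEdge
    · obtain ⟨a, b, hab⟩ := exists_selects s Δ' (h.invariants hl hc).1 hd
      obtain ⟨k', D, hk, hD⟩ := ih (h.step hd hab) (by omega)
      exact ⟨k', D, by omega, hD⟩
    · exact ⟨k, Δ', le_rfl, h, hd⟩

/-- The crude bound `5 ^ n` gives termination, so each partial run extends to a complete one, and it
suffices to bound the lengths of complete runs. -/
theorem Positive.everyRunDynkin {s : Strategy} {Δ : Bigraph n} (hp : Δ.Positive) (hn : 1 ≤ n)
    (hl : Δ.LoopFree) (hc : Δ.Connected) {N : ℕ}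
    (hN : ∀ k D, Returns s Δ k D → D.IsDynkin → k ≤ N) : Δ.EveryRunDynkin s N := by
  have dynkin (k : ℕ) (D : Bigraph n) (h : Returns s Δ k D) : D.IsDynkin := by
    obtain ⟨h1, h2, h3⟩ := h.1.invariants hl hc
    exact (h3.2 hp).isDynkin hn h1 h2 h.2
  refine ⟨fun k Δ' h => ?_, dynkin⟩
  have hbound (k : ℕ) (Δ' : Bigraph n) (h : Execution s Δ k Δ') : k ≤ 5 ^ n := by
    obtain ⟨hp', hle⟩ := h.ncard_posRoots hp
    exact (Nat.le_add_left _ _).trans (hle.trans hp'.posRoots_subset.2)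
  obtain ⟨k', D, hk, hD⟩ := h.exists_returns hl hc hbound
  exact hk.trans (hN k' D hD (dynkin k' D hD))

theorem EveryRunDynkin.someRunDynkin {s : Strategy} {Δ : Bigraph n} {N : ℕ}
    (h : Δ.EveryRunDynkin s N) (hl : Δ.LoopFree) (hc : Δ.Connected) : Δ.SomeRunDynkin s N := by
  obtain ⟨k, D, -, hD⟩ := Execution.start.exists_returns hl hc h.1
  exact ⟨k, D, h.1 k D hD.1, hD, h.2 k D hD⟩

theorem SomeRunDynkin.positive {s : Strategy} {Δ : Bigraph n} {N : ℕ}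
    (h : Δ.SomeRunDynkin s N) (hl : Δ.LoopFree) (hc : Δ.Connected) : Δ.Positive := by
  obtain ⟨k, D, -, hD, hDynkin⟩ := h
  exact (hD.1.invariants hl hc).2.2.1 hDynkin.positive

theorem positive_iff_runs {s : Strategy} {Δ : Bigraph n} (hn : 1 ≤ n) (hl : Δ.LoopFree)
    (hc : Δ.Connected) {N : ℕ}
    (hN : Δ.Positive → ∀ k D, Returns s Δ k D → D.IsDynkin → k ≤ N) :
    (Δ.Positive ↔ Δ.EveryRunDynkin s N) ∧ (Δ.Positive ↔ Δ.SomeRunDynkin s N) := by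
  have h1 (hp : Δ.Positive) : Δ.EveryRunDynkin s N := hp.everyRunDynkin hn hl hc (hN hp)
  exact ⟨⟨h1, fun h => (h.someRunDynkin hl hc).positive hl hc⟩,
    ⟨fun hp => (h1 hp).someRunDynkin hl hc, fun h => h.positive hl hc⟩⟩

end Bigraph

theorem theorem1 (n : ℕ) (hn : 1 ≤ n) (Δ : Bigraph n) (hloop : Δ.LoopFree)
    (hconn : Δ.Connected) (s : Strategy) :
    ((Δ.Positive ↔ Δ.EveryRunDynkin s (igPos n)) ∧
      (Δ.Positive ↔ Δ.SomeRunDynkin s (igPos n))) ∧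
    ((∃ v : Fin n → ℤ, Δ.IsPositiveSincereRoot v) →
      (Δ.Positive ↔ Δ.EveryRunDynkin s (igPoss n)) ∧
      (Δ.Positive ↔ Δ.SomeRunDynkin s (igPoss n))) := by
  refine ⟨Bigraph.positive_iff_runs hn hloop hconn fun hp k D hD hDynkin => ?_, fun ⟨v, hv⟩ =>
    Bigraph.positive_iff_runs hn hloop hconn fun hp k D hD hDynkin => ?_⟩
  -- Counting roots gives `n + k ≤ igPos n + n`.
  · have h1 := (hD.1.ncard_posRoots hp).2
    have h2 := hp.le_ncard_posRoots
    have h3 := hDynkin.ncard_posRoots_le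
    omega
  -- Comparing heights gives `n + k ≤ igPoss n + n`.
  · obtain ⟨w, hw, -, hsum⟩ := hD.1.sincere hp hv
    have := hDynkin.sum_le hw
    omega
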